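/- Let $0<p,q\le\infty$ and $\alpha>0$. For an entire function $f$ and $r\ge 0$ put $M_p(f,r)=\left(\frac1{2\pi}\int_0^{2\pi}|f(re^{i\theta})|^p\,d\theta\right)^{1/p}$ if $p<\infty$ and $M_\infty(f,r)=\sup_{|z|=r}|f(z)|$. Put $$\|f\|_{p,q,\alpha}=\left(\alpha q\int_0^\infty M_p(f,r)^q e^{-\frac{\alpha q}{2}r^2}\,r\,dr\right)^{1/q}\quad (q<\infty),\qquad \|f\|_{p,\infty,\alpha}=\sup_{r\ge 0}M_p(f,r)e^{-\frac{\alpha}{2}r^2}.$$ Let the mixed-norm Fock space $F^{p,q,\alpha}$ be the space of all entire functions $f$ with $\|f\|_{p,q,\alpha}<\infty$, with the vector topology in which the balls $\{f:\|f\|_{p,q,\alpha}<\varepsilon\}$, $\varepsilon>0$, form a basis of neighbourhoods of $0$. Let $\mu$ be a positive Borel measure on $(0,\infty)$ with $\int_0^\infty\frac{d\mu(t)}{t}=1$, and let $$\mathscr{H}_\mu(f)(z)=\int_0^\infty f\left(\frac zt\right)\frac{d\mu(t)}{t},\qquad z\in\mathbb C,$$ be the Hausdorff operator induced by $\mu$.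 **Theorem.** $\mathscr{H}_\mu:F^{p,q,\alpha}\to F^{p,q,\alpha}$ is compact if and only if $\mu((0,1])=0$. Here "compact" means that $\mathscr{H}_\mu$ is well defined as a linear map of $F^{p,q,\alpha}$ into itself (for every $f\in F^{p,q,\alpha}$ the integral converges absolutely at every $z\in\mathbb C$ and $\mathscr{H}_\mu(f)\in F^{p,q,\alpha}$) and that it maps some neighbourhood of $0$ into a relatively compact subset of $F^{p,q,\alpha}$. -/

import Mathlib

open MeasureTheory Set
open scoped ENNReal Topology

noncomputable section

/-- The integral mean `M_p(f, r)` of `f` over the circle of radius `r`, as an extended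
nonnegative real: `(1/(2π) ∫_0^{2π} |f(r e^{iθ})|^p dθ)^{1/p}` for `p < ∞`, and
`sup_{|z| = r} |f z|` for `p = ∞`. -/
def integralMean (p : ℝ≥0∞) (f : ℂ → ℂ) (r : ℝ) : ℝ≥0∞ :=
  if p = ∞ then ⨆ (z : ℂ) (_ : ‖z‖ = r), ‖f z‖ₑ
  else (ENNReal.ofReal (1 / (2 * Real.pi)) *
    ∫⁻ θ in Ioc (0 : ℝ) (2 * Real.pi),
      ‖f ((r : ℂ) * Complex.exp ((θ : ℂ) * Complex.I))‖ₑ ^ p.toReal) ^ (1 / p.toReal)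

/-- The mixed Fock (quasi-)norm `‖f‖_{p,q,α}`, as an extended nonnegative real:
`(α q ∫_0^∞ M_p(f, r)^q e^{-α q r² / 2} r dr)^{1/q}` for `q < ∞`, and
`sup_{r ≥ 0} M_p(f, r) e^{-α r² / 2}` for `q = ∞`. -/
def fockNorm (p q : ℝ≥0∞) (α : ℝ) (f : ℂ → ℂ) : ℝ≥0∞ :=
  if q = ∞ then
    ⨆ (r : ℝ) (_ : 0 ≤ r), integralMean p f r * ENNReal.ofReal (Real.exp (-(α / 2) * r ^ 2))
  else (ENNReal.ofReal (α * q.toReal) *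
    ∫⁻ r in Ioi (0 : ℝ), integralMean p f r ^ q.toReal *
      ENNReal.ofReal (Real.exp (-(α * q.toReal / 2) * r ^ 2) * r)) ^ (1 / q.toReal)

/-- A constant for the quasi-triangle inequality. -/
def quasiConst (p : ℝ≥0∞) : ℝ≥0∞ := 2 ^ (1 / p.toReal)

lemma quasiConst_ne_top (p : ℝ≥0∞) : quasiConst p ≠ ∞ :=
  ENNReal.rpow_ne_top_of_nonneg (by positivity) (by simp)

lemma quasiConst_ne_zero (p : ℝ≥0∞) : quasiConst p ≠ 0 := by
  simp [quasiConst, ENNReal.rpow_eq_zero_iff]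

lemma rpow_lintegral_le_max {X : Type*} [MeasurableSpace X] (ν : Measure X) {s : ℝ} (hs : 0 < s)
    (w K : ℝ≥0∞) (hK : K ≠ ∞) (a b c φ : X → ℝ≥0∞) (ha : Measurable a) (hφ : Measurable φ)
    (h : ∀ x, c x ≤ K * max (a x) (b x)) :
    (w * ∫⁻ x, c x ^ s * φ x ∂ν) ^ (1 / s) ≤
      K * 2 ^ (1 / s) * max ((w * ∫⁻ x, a x ^ s * φ x ∂ν) ^ (1 / s))
        ((w * ∫⁻ x, b x ^ s * φ x ∂ν) ^ (1 / s)) := by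
  set A := w * ∫⁻ x, a x ^ s * φ x ∂ν with hA
  set B := w * ∫⁻ x, b x ^ s * φ x ∂ν with hB
  have hKs : K ^ s ≠ ∞ := ENNReal.rpow_ne_top_of_nonneg hs.le hK
  have h1 : ∫⁻ x, c x ^ s * φ x ∂ν ≤
      K ^ s * (∫⁻ x, a x ^ s * φ x ∂ν + ∫⁻ x, b x ^ s * φ x ∂ν) := by
    rw [← lintegral_add_left (f := fun x => a x ^ s * φ x) ((ha.pow_const s).mul hφ), ← lintegral_const_mul' _ _ hKs]
    refine lintegral_mono fun x => ?_
    have : c x ^ s ≤ K ^ s * (a x ^ s + b x ^ s) := by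
      calc c x ^ s ≤ (K * max (a x) (b x)) ^ s := ENNReal.rpow_le_rpow (h x) hs.le
        _ = K ^ s * max (a x) (b x) ^ s := ENNReal.mul_rpow_of_nonneg _ _ hs.le
        _ ≤ _ := by
          gcongr
          rcases le_total (a x) (b x) with h' | h'
          · rw [max_eq_right h']; exact le_add_self
          · rw [max_eq_left h']; exact le_self_add
    calc c x ^ s * φ x ≤ K ^ s * (a x ^ s + b x ^ s) * φ x := by gcongr
      _ = _ := by ring
  have h2 : w * ∫⁻ x, c x ^ s * φ x ∂ν ≤ K ^ s * (2 * max A B) := by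
    calc w * ∫⁻ x, c x ^ s * φ x ∂ν
        ≤ w * (K ^ s * (∫⁻ x, a x ^ s * φ x ∂ν + ∫⁻ x, b x ^ s * φ x ∂ν)) := by gcongr
      _ = K ^ s * (A + B) := by rw [hA, hB]; ring
      _ ≤ _ := by
        rw [two_mul]
        gcongr
        · exact le_max_left _ _
        · exact le_max_right _ _
  have hs' : 0 ≤ 1 / s := by positivity
  calc (w * ∫⁻ x, c x ^ s * φ x ∂ν) ^ (1 / s) ≤ (K ^ s * (2 * max A B)) ^ (1 / s) :=
        ENNReal.rpow_le_rpow h2 hs'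
    _ = K * 2 ^ (1 / s) * max (A ^ (1 / s)) (B ^ (1 / s)) := by
      rw [ENNReal.mul_rpow_of_nonneg _ _ hs', ENNReal.mul_rpow_of_nonneg _ _ hs',
        ← ENNReal.rpow_mul, mul_one_div_cancel hs.ne', ENNReal.rpow_one, mul_assoc,
        (ENNReal.monotone_rpow_of_nonneg hs').map_max]

lemma rpow_lintegral_const_mul {X : Type*} [MeasurableSpace X] (ν : Measure X) {s : ℝ}
    (hs : 0 < s) (w K : ℝ≥0∞) (hK : K ≠ ∞) (a φ : X → ℝ≥0∞) :
    (w * ∫⁻ x, (K * a x) ^ s * φ x ∂ν) ^ (1 / s) =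
      K * (w * ∫⁻ x, a x ^ s * φ x ∂ν) ^ (1 / s) := by
  have hKs : K ^ s ≠ ∞ := ENNReal.rpow_ne_top_of_nonneg hs.le hK
  have hs' : 0 ≤ 1 / s := by positivity
  simp_rw [ENNReal.mul_rpow_of_nonneg _ _ hs.le, mul_assoc]
  rw [lintegral_const_mul' _ _ hKs, mul_left_comm, ENNReal.mul_rpow_of_nonneg _ _ hs',
    ← ENNReal.rpow_mul, mul_one_div_cancel hs.ne', ENNReal.rpow_one]

lemma measurable_integralMean (p : ℝ≥0∞) {f : ℂ → ℂ} (hf : Continuous f) :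
    Measurable fun r : ℝ => integralMean p f r := by
  by_cases hp : p = ∞
  · have : Measurable fun r : ℝ => ⨆ θ : ℝ, ‖f ((|r| : ℝ) * Complex.exp (θ * Complex.I))‖ₑ := by
      refine (lowerSemicontinuous_iSup fun θ => ?_).measurable
      exact Continuous.lowerSemicontinuous (by fun_prop)
    have h2 : (fun r : ℝ => integralMean p f r) = (Ici (0 : ℝ)).indicator
        fun r : ℝ => ⨆ θ : ℝ, ‖f ((|r| : ℝ) * Complex.exp (θ * Complex.I))‖ₑ := by
      ext r
      simp only [integralMean, hp, if_true]
      by_cases hr : 0 ≤ r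
      · rw [indicator_of_mem (by exact hr), abs_of_nonneg hr]
        apply le_antisymm
        · refine iSup₂_le fun z hz => ?_
          refine le_trans (le_of_eq ?_) (le_iSup _ (Complex.arg z))
          rw [← hz, Complex.norm_mul_exp_arg_mul_I]
        · refine iSup_le fun θ => ?_
          exact le_iSup₂ (f := fun (z : ℂ) (_ : ‖z‖ = r) => ‖f z‖ₑ) _
            (by simp [Complex.norm_exp_ofReal_mul_I, abs_of_nonneg hr])
      · rw [indicator_of_notMem (by exact hr)]
        simp only [ENNReal.iSup_eq_zero]
        intro z hz
        exact absurd (hz ▸ norm_nonneg z) hr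
    rw [h2]
    exact this.indicator measurableSet_Ici
  · simp only [integralMean, hp, if_false]
    refine Measurable.pow_const (Measurable.const_mul ?_ _) _
    refine Measurable.lintegral_prod_right'
      (f := fun x : ℝ × ℝ => ‖f ((x.1 : ℂ) * Complex.exp ((x.2 : ℂ) * Complex.I))‖ₑ ^ p.toReal) ?_
    refine Measurable.pow_const (Continuous.measurable ?_) _
    fun_prop

lemma integralMean_add_le {p : ℝ≥0∞} (hp : 0 < p) {f g : ℂ → ℂ} (hf : Continuous f) (r : ℝ) :
    integralMean p (f + g) r ≤
      2 * quasiConst p * max (integralMean p f r) (integralMean p g r) := by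
  have key : ∀ z, ‖(f + g) z‖ₑ ≤ 2 * max ‖f z‖ₑ ‖g z‖ₑ := fun z => by
    refine (enorm_add_le _ _).trans ?_
    rw [two_mul]
    exact add_le_add (le_max_left _ _) (le_max_right _ _)
  by_cases hpt : p = ∞
  · simp only [integralMean, hpt, if_true, quasiConst, ENNReal.toReal_top, div_zero,
      ENNReal.rpow_zero, mul_one]
    refine iSup₂_le fun z hz => (key z).trans ?_
    gcongr
    · exact le_iSup₂ (f := fun (z : ℂ) (_ : ‖z‖ = r) => ‖f z‖ₑ) z hz
    · exact le_iSup₂ (f := fun (z : ℂ) (_ : ‖z‖ = r) => ‖g z‖ₑ) z hz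
  · simp only [integralMean, hpt, if_false, quasiConst]
    have := rpow_lintegral_le_max (volume.restrict (Ioc (0 : ℝ) (2 * Real.pi)))
      (ENNReal.toReal_pos hp.ne' hpt) (ENNReal.ofReal (1 / (2 * Real.pi))) 2 (by simp)
      (fun θ : ℝ => ‖f ((r : ℂ) * Complex.exp ((θ : ℂ) * Complex.I))‖ₑ)
      (fun θ : ℝ => ‖g ((r : ℂ) * Complex.exp ((θ : ℂ) * Complex.I))‖ₑ)
      (fun θ : ℝ => ‖(f + g) ((r : ℂ) * Complex.exp ((θ : ℂ) * Complex.I))‖ₑ)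
      (fun _ => 1) (Continuous.measurable (by fun_prop)) measurable_const (fun θ => key _)
    simpa only [mul_one] using this

lemma integralMean_smul {p : ℝ≥0∞} (hp : 0 < p) (c : ℂ) (f : ℂ → ℂ) (r : ℝ) :
    integralMean p (c • f) r = ‖c‖ₑ * integralMean p f r := by
  by_cases hpt : p = ∞
  · simp only [integralMean, hpt, if_true, Pi.smul_apply, enorm_smul, ENNReal.mul_iSup]
  · simp only [integralMean, hpt, if_false, Pi.smul_apply, enorm_smul]
    have := rpow_lintegral_const_mul (volume.restrict (Ioc (0 : ℝ) (2 * Real.pi)))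
      (ENNReal.toReal_pos hp.ne' hpt) (ENNReal.ofReal (1 / (2 * Real.pi))) ‖c‖ₑ (by simp)
      (fun θ : ℝ => ‖f ((r : ℂ) * Complex.exp ((θ : ℂ) * Complex.I))‖ₑ) (fun _ => 1)
    simpa only [mul_one] using this

lemma fockNorm_add_le {p q : ℝ≥0∞} (hp : 0 < p) (hq : 0 < q) (α : ℝ) {f g : ℂ → ℂ}
    (hf : Continuous f) :
    fockNorm p q α (f + g) ≤
      2 * quasiConst p * quasiConst q * max (fockNorm p q α f) (fockNorm p q α g) := by
  by_cases hqt : q = ∞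
  · simp only [fockNorm, hqt, if_true]
    have hq1 : quasiConst ∞ = 1 := by simp [quasiConst]
    rw [hq1, mul_one]
    refine iSup₂_le fun r hr => ?_
    calc integralMean p (f + g) r * ENNReal.ofReal (Real.exp (-(α / 2) * r ^ 2))
        ≤ 2 * quasiConst p * max (integralMean p f r) (integralMean p g r) *
          ENNReal.ofReal (Real.exp (-(α / 2) * r ^ 2)) := by
          gcongr; exact integralMean_add_le hp hf r
      _ = 2 * quasiConst p * max
          (integralMean p f r * ENNReal.ofReal (Real.exp (-(α / 2) * r ^ 2)))
          (integralMean p g r * ENNReal.ofReal (Real.exp (-(α / 2) * r ^ 2))) := by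
          rw [mul_assoc, max_mul_of_nonneg _ _ (zero_le)]
      _ ≤ _ := by
        gcongr
        · exact le_iSup₂ (f := fun (r : ℝ) (_ : 0 ≤ r) =>
            integralMean p f r * ENNReal.ofReal (Real.exp (-(α / 2) * r ^ 2))) r hr
        · exact le_iSup₂ (f := fun (r : ℝ) (_ : 0 ≤ r) =>
            integralMean p g r * ENNReal.ofReal (Real.exp (-(α / 2) * r ^ 2))) r hr
  · simp only [fockNorm, hqt, if_false]
    exact rpow_lintegral_le_max (volume.restrict (Ioi (0 : ℝ)))
      (ENNReal.toReal_pos hq.ne' hqt) (ENNReal.ofReal (α * q.toReal)) (2 * quasiConst p)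
      (ENNReal.mul_ne_top (by simp) (quasiConst_ne_top p)) _ _ _
      (fun r : ℝ => ENNReal.ofReal (Real.exp (-(α * q.toReal / 2) * r ^ 2) * r))
      (measurable_integralMean p hf) (by fun_prop) (integralMean_add_le hp hf)

lemma fockNorm_smul {p q : ℝ≥0∞} (hp : 0 < p) (hq : 0 < q) (α : ℝ) (c : ℂ) (f : ℂ → ℂ) :
    fockNorm p q α (c • f) = ‖c‖ₑ * fockNorm p q α f := by
  by_cases hqt : q = ∞
  · simp only [fockNorm, hqt, if_true, integralMean_smul hp, ENNReal.mul_iSup, mul_assoc]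
  · simp only [fockNorm, hqt, if_false, integralMean_smul hp]
    exact rpow_lintegral_const_mul _ (ENNReal.toReal_pos hq.ne' hqt) _ _ (by simp) _ _

lemma fockNorm_zero {p q : ℝ≥0∞} (hp : 0 < p) (hq : 0 < q) (α : ℝ) :
    fockNorm p q α 0 = 0 := by
  simpa using fockNorm_smul hp hq α 0 0

lemma fockNorm_neg {p q : ℝ≥0∞} (hp : 0 < p) (hq : 0 < q) (α : ℝ) (f : ℂ → ℂ) :
    fockNorm p q α (-f) = fockNorm p q α f := by
  simpa using fockNorm_smul hp hq α (-1) f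

/-- The mixed norm Fock space `F^{p,q,α}`: all entire functions with `‖f‖_{p,q,α} < ∞`. -/
def MixedFock (p q : ℝ≥0∞) [hp : Fact (0 < p)] [hq : Fact (0 < q)] (α : ℝ) :
    Submodule ℂ (ℂ → ℂ) where
  carrier := {f | Differentiable ℂ f ∧ fockNorm p q α f < ∞}
  zero_mem' := ⟨differentiable_const 0, by simp [fockNorm_zero hp.out hq.out]⟩
  add_mem' := fun {f g} hf hg => ⟨hf.1.add hg.1,
    (fockNorm_add_le hp.out hq.out α hf.1.continuous).trans_lt <|
      ENNReal.mul_lt_top (ENNReal.mul_lt_top (ENNReal.mul_lt_top (by simp)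
        (quasiConst_ne_top p).lt_top) (quasiConst_ne_top q).lt_top) (max_lt hf.2 hg.2)⟩
  smul_mem' := fun c f hf => ⟨hf.1.const_smul c, by
    rw [fockNorm_smul hp.out hq.out]
    exact ENNReal.mul_lt_top (by simp) hf.2⟩

/-- The balls `{f | ‖f‖_{p,q,α} < ε}`, `ε > 0`, form a basis of neighbourhoods of `0` for a group
topology on `F^{p,q,α}`. -/
@[reducible] def fockFilterBasis (p q : ℝ≥0∞) [hp : Fact (0 < p)] [hq : Fact (0 < q)] (α : ℝ) :
    AddGroupFilterBasis (MixedFock p q α) where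
  sets := {U | ∃ ε : ℝ≥0∞, 0 < ε ∧ U = {f : MixedFock p q α | fockNorm p q α f < ε}}
  nonempty := ⟨_, 1, one_pos, rfl⟩
  inter_sets := by
    rintro _ _ ⟨ε, hε, rfl⟩ ⟨δ, hδ, rfl⟩
    refine ⟨_, ⟨min ε δ, lt_min hε hδ, rfl⟩, fun f hf => ?_⟩
    have hf' : fockNorm p q α f < min ε δ := hf
    exact ⟨hf'.trans_le (min_le_left _ _), hf'.trans_le (min_le_right _ _)⟩
  zero' := by
    rintro _ ⟨ε, hε, rfl⟩
    show fockNorm p q α 0 < ε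
    rwa [fockNorm_zero hp.out hq.out]
  add' := by
    rintro _ ⟨ε, hε, rfl⟩
    have hC : 2 * quasiConst p * quasiConst q ≠ ∞ := ENNReal.mul_ne_top
      (ENNReal.mul_ne_top (by simp) (quasiConst_ne_top p)) (quasiConst_ne_top q)
    have hC0 : 2 * quasiConst p * quasiConst q ≠ 0 :=
      mul_ne_zero (mul_ne_zero (by simp) (quasiConst_ne_zero p)) (quasiConst_ne_zero q)
    refine ⟨_, ⟨ε / (2 * quasiConst p * quasiConst q), ENNReal.div_pos hε.ne' hC, rfl⟩, ?_⟩
    rintro _ ⟨f, hf, g, hg, rfl⟩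
    refine (fockNorm_add_le hp.out hq.out α f.2.1.continuous).trans_lt ?_
    rw [mul_comm]
    exact (ENNReal.lt_div_iff_mul_lt (Or.inl hC0) (Or.inl hC)).1 (max_lt hf hg)
  neg' := by
    rintro _ ⟨ε, hε, rfl⟩
    refine ⟨_, ⟨ε, hε, rfl⟩, fun f hf => ?_⟩
    show fockNorm p q α (-(f : ℂ → ℂ)) < ε
    rw [fockNorm_neg hp.out hq.out]
    exact hf
  conj' := by
    rintro f _ ⟨ε, hε, rfl⟩
    exact ⟨_, ⟨ε, hε, rfl⟩, fun g hg => by simpa using hg⟩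

/-- The (translation invariant) topology of `F^{p,q,α}` given by its quasi-norm. It is not an instance,
since the subspace topology inherited from `ℂ → ℂ` (pointwise convergence) already is one. -/
@[reducible] def fockTopology (p q : ℝ≥0∞) [Fact (0 < p)] [Fact (0 < q)] (α : ℝ) :
    TopologicalSpace (MixedFock p q α) :=
  (fockFilterBasis p q α).topology

/-- The integrand `f (z / t) / t` of the Hausdorff operator. -/
def hausdorffIntegrand (f : ℂ → ℂ) (z : ℂ) (t : Ioi (0 : ℝ)) : ℂ :=
  f (z / ((t : ℝ) : ℂ)) / ((t : ℝ) : ℂ)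

/-- The Hausdorff operator `(H_μ f)(z) = ∫_0^∞ f (z / t) dμ(t) / t`. -/
def hausdorff (μ : Measure (Ioi (0 : ℝ))) (f : ℂ → ℂ) (z : ℂ) : ℂ :=
  ∫ t, hausdorffIntegrand f z t ∂μ

/-- `H_μ` is a compact operator from `F^{p,q,α}` to itself. This includes that `H_μ` is well defined
there: for every `f` in the space the defining integrals converge (absolutely) at every point `z`
and give a function `H_μ f` of the space. Compactness means that some neighbourhood of the origin
is mapped into a compact set. -/
def IsCompactHausdorff (p q : ℝ≥0∞) [Fact (0 < p)] [Fact (0 < q)] (α : ℝ)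
    (μ : Measure (Ioi (0 : ℝ))) : Prop :=
  ∃ T : MixedFock p q α →ₗ[ℂ] MixedFock p q α,
    (∀ (f : MixedFock p q α) (z : ℂ), Integrable (hausdorffIntegrand f z) μ ∧
      (T f : ℂ → ℂ) z = hausdorff μ f z) ∧
    @IsCompactOperator _ _ _ (fockTopology p q α) (fockTopology p q α) T

end

/-!
# Compactness of Hausdorff operators on mixed norm Fock spaces

Write `G = radialMax f` for the radial maximal function `G z = sup_{0 ≤ x ≤ 1} |f (x z)|`.

**Sufficiency.** If `μ` has no mass on `(0, 1]`, then `|H_μ f| ≤ G` pointwise, so everything rests on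
the bound `‖G‖ ≤ C ‖f‖` (`mixedNorm_radialMax_le`), which has to hold for all exponents, including
`p < 1` where Minkowski's inequality is not available. Since `|f|^p` is subharmonic (Jensen's formula
and convexity of `exp`: `norm_rpow_le_circleAverage`), circular means increase with the radius, and
averaging over discs gives a local maximal inequality (`lintegral_iSup_Icc_le`): the supremum of
`|f|^p` over short radial segments is controlled in the mean by one slightly larger circle. The disc
of radius `r` is cut into layers on which `|z|²` varies by `1`; the `k`-th layer is controlled by the
circle of radius `√(r² + 8 - k)` (`circleMean_radialMax_le`). A shift of `r²` by `k` gains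
`e^{-α k / 2}` in the Gaussian weight, hence the layers can be summed for every `q`
(`radialNorm_le_of_shift`).

For `τ > 1` the finer estimate `|H_μ f (z)| ≤ a G(z) + G(z / τ)` holds, where `a` is the mass of
`dμ(t) / t` on `(1, τ)`. This mass is small for `τ` near `1`, while the dilated term is small outside
a large disc by Gaussian decay and inside it as soon as `f` is locally uniformly small
(`fockNorm_hausdorff_le_of_bound`). So `H_μ` maps bounded sequences tending to `0` locally uniformly
to null sequences, and with Montel's theorem (`exists_subseq_tendsto_of_entire`) and Fatou's lemma
(`fockNorm_le_of_tendsto`) the image of the closed unit ball is sequentially compact.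

**Necessity.** The monomial `z ^ n` is an eigenvector with eigenvalue `∫ t^{-n-1} dμ(t)`, which is at
least `∫_{(0,1]} dμ(t) / t`. Along the normalised monomials a compact operator has a cluster point of
images; point evaluations are bounded (`enorm_le_fockNorm`), so comparing the values at `z` and `2 z`
shows that this cluster point is `0`, and the eigenvalues cannot stay away from `0`.
-/

noncomputable section

/-! ### Subharmonicity of powers of the modulus -/

lemma continuous_norm_rpow {f : ℂ → ℂ} (hf : Continuous f) {s : ℝ} (hs : 0 < s) :
    Continuous fun z => ‖f z‖ ^ s :=
  hf.norm.rpow_const fun _ => Or.inr hs.le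

/-- The sub-mean value property of `|f|^s` for every `s > 0`: Jensen's formula gives it for `log |f|`,
and `x ↦ exp (s x)` is convex and increasing. -/
lemma norm_rpow_le_circleAverage {f : ℂ → ℂ} (hf : Differentiable ℂ f) {s : ℝ} (hs : 0 < s)
    (c : ℂ) (R : ℝ) : ‖f c‖ ^ s ≤ Real.circleAverage (fun z => ‖f z‖ ^ s) c R := by
  have hcont : Continuous fun z => ‖f z‖ ^ s := continuous_norm_rpow hf.continuous hs
  rcases eq_or_ne R 0 with rfl | hR
  · simp
  rcases eq_or_ne (f c) 0 with hc | hc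
  · rw [hc, norm_zero, Real.zero_rpow hs.ne']
    exact Real.circleAverage_nonneg_of_nonneg fun z _ => by positivity
  have han : ∀ U : Set ℂ, AnalyticOnNhd ℂ f U := fun U z _ => hf.analyticAt z
  have hlog : Real.log ‖f c‖ ≤ Real.circleAverage (Real.log ‖f ·‖) c R := by
    rw [(han _).circleAverage_log_norm hR hc]
    refine le_add_of_nonneg_left (finsum_nonneg fun u => ?_)
    by_cases hu : u ∈ Metric.closedBall c |R|
    · refine mul_nonneg ?_ ?_
      · exact_mod_cast (MeromorphicOn.AnalyticOnNhd.divisor_nonneg (han _)) u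
      · rcases eq_or_ne u c with rfl | huc
        · simp
        rw [← Real.log_abs, abs_mul, abs_of_nonneg (inv_nonneg.2 (norm_nonneg (c - u)))]
        refine Real.log_nonneg ?_
        rw [← div_eq_mul_inv, one_le_div (norm_pos_iff.2 (sub_ne_zero.2 huc.symm))]
        rwa [← dist_eq_norm, dist_comm]
    · simp [Function.locallyFinsuppWithin.apply_eq_zero_of_notMem _ hu]
  -- zeros of `f` are negligible on the circle, so there `|f|^s = exp (s log |f|)`
  have hint : CircleIntegrable (Real.log ‖f ·‖) c R :=
    MeromorphicOn.circleIntegrable_log_norm fun z _ => (hf.analyticAt z).meromorphicAt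
  have hcod : (fun z => Real.exp (s * Real.log ‖f z‖)) =ᶠ[Filter.codiscreteWithin
      (Metric.sphere c |R|)] fun z => ‖f z‖ ^ s := by
    have h1 := (han univ).preimage_zero_mem_codiscrete (x := c) hc
    filter_upwards [Filter.codiscreteWithin_mono (subset_univ _) h1] with z hz
    have hz' : 0 < ‖f z‖ := norm_pos_iff.2 hz
    rw [Real.rpow_def_of_pos hz', mul_comm]
  have hae : (fun θ => Real.exp (s * Real.log ‖f (circleMap c R θ)‖)) =ᵐ[volume.restrict
      (uIoc 0 (2 * Real.pi))] fun θ => ‖f (circleMap c R θ)‖ ^ s :=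
    ae_restrict_le_codiscreteWithin measurableSet_uIoc
      (Filter.codiscreteWithin_mono (subset_univ _) (circleMap_preimage_codiscrete hR hcod))
  have h2 : IntervalIntegrable (fun θ => ‖f (circleMap c R θ)‖ ^ s) volume 0 (2 * Real.pi) :=
    (hcont.comp (continuous_circleMap c R)).intervalIntegrable _ _
  have hpi : (0 : ℝ) ≤ 2 * Real.pi := by positivity
  rw [← Real.circleAverage_congr_codiscreteWithin hcod hR]
  rw [Real.circleAverage_eq_intervalAverage] at hlog ⊢
  have : IsFiniteMeasure (volume.restrict (uIoc 0 (2 * Real.pi))) := ⟨by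
    simp [uIoc_of_le hpi, ENNReal.mul_lt_top]⟩
  have : NeZero (volume.restrict (uIoc 0 (2 * Real.pi))) := ⟨by
    simp [uIoc_of_le hpi, Real.pi_pos]⟩
  have hJ := ConvexOn.map_average_le (μ := volume.restrict (uIoc 0 (2 * Real.pi)))
    (f := fun θ => s * Real.log ‖f (circleMap c R θ)‖) convexOn_exp
    Real.continuous_exp.continuousOn isClosed_univ (by simp)
    ((intervalIntegrable_iff.1 hint).const_mul s)
    ((intervalIntegrable_iff.1 h2).congr hae.symm)
  refine le_trans ?_ hJ
  rw [Real.rpow_def_of_pos (norm_pos_iff.2 hc), Real.exp_le_exp, mul_comm]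
  calc s * Real.log ‖f c‖ ≤ s * _ := mul_le_mul_of_nonneg_left hlog hs.le
    _ = _ := by simp only [average_eq, integral_const_mul, smul_eq_mul]; ring

/-- The circle through `c` about the origin may be parametrised from the starting point `c`. -/
lemma circleAverage_comp_mul_exp (g : ℂ → ℝ) (c : ℂ) :
    Real.circleAverage (fun z => g (c * z)) 0 1 = Real.circleAverage g 0 ‖c‖ := by
  rw [Real.circleAverage_eq_integral_add (f := g) (Complex.arg c), Real.circleAverage]
  congr 1
  refine intervalIntegral.integral_congr fun θ _ => ?_
  simp only [circleMap, zero_add, Complex.ofReal_one, one_mul, Complex.ofReal_add, add_mul,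
    Complex.exp_add]
  congr 1
  rw [mul_left_comm, Complex.norm_mul_exp_arg_mul_I, mul_comm]

/-- The mean of `|f|^s` over the circle through `z` about the origin is a subharmonic function of
`z`. -/
lemma circleAverage_norm_rpow_submean {f : ℂ → ℂ} (hf : Differentiable ℂ f) {s : ℝ} (hs : 0 < s)
    (x δ : ℝ) (hx : 0 ≤ x) : Real.circleAverage (fun z => ‖f z‖ ^ s) 0 x ≤
      Real.circleAverage (fun z => Real.circleAverage (fun w => ‖f w‖ ^ s) 0 ‖z‖) x δ := by
  have hc := continuous_norm_rpow hf.continuous hs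
  have h0 : Real.circleAverage (fun z => ‖f z‖ ^ s) 0 x =
      Real.circleAverage (fun z => ‖f (x * z)‖ ^ s) 0 1 := by
    rw [circleAverage_comp_mul_exp (fun z => ‖f z‖ ^ s) x]
    simp [abs_of_nonneg hx]
  have h1 : ∀ z : ℂ, Real.circleAverage (fun w => ‖f w‖ ^ s) 0 ‖z‖ =
      Real.circleAverage (fun w => ‖f (z * w)‖ ^ s) 0 1 := fun z =>
    (circleAverage_comp_mul_exp (fun z => ‖f z‖ ^ s) z).symm
  have h2 : Real.circleAverage (fun z => Real.circleAverage (fun w => ‖f (z * w)‖ ^ s) 0 1) x δ =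
      Real.circleAverage (fun w => Real.circleAverage (fun z => ‖f (z * w)‖ ^ s) x δ) 0 1 := by
    simp only [Real.circleAverage, intervalIntegral.integral_smul]
    congr 2
    refine intervalIntegral_intervalIntegral_swap ?_
    have hF : Continuous (Function.uncurry fun φ θ : ℝ =>
        ‖f (circleMap x δ φ * circleMap 0 1 θ)‖ ^ s) := hc.comp (by fun_prop)
    have hI : IntegrableOn _ (uIcc 0 (2 * Real.pi) ×ˢ uIcc 0 (2 * Real.pi))
      (volume : Measure (ℝ × ℝ)) :=
      hF.continuousOn.integrableOn_compact (isCompact_uIcc.prod isCompact_uIcc)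
    exact hI.mono_set (prod_mono uIoc_subset_uIcc uIoc_subset_uIcc)
  simp_rw [h1]
  rw [h0, h2]
  refine Real.circleAverage_mono ?_ ?_ fun w hw => ?_
  · exact (hc.comp (by fun_prop)).continuousOn.circleIntegrable'
  · refine ContinuousOn.circleIntegrable' (Continuous.continuousOn ?_)
    have hF : Continuous (Function.uncurry fun (w : ℂ) (θ : ℝ) =>
        ‖f (circleMap x δ θ * w)‖ ^ s) := hc.comp (by fun_prop)
    exact (intervalIntegral.continuous_parametric_intervalIntegral_of_continuous' (μ := volume)
      hF 0 (2 * Real.pi)).const_smul (2 * Real.pi)⁻¹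
  · exact norm_rpow_le_circleAverage (f := fun z => f (z * w)) (by fun_prop) hs x δ

/-- Circular means of `|f|^s` increase with the radius: the maximum principle for the radial
subharmonic function given by the circular means. -/
lemma circleAverage_norm_rpow_mono {f : ℂ → ℂ} (hf : Differentiable ℂ f) {s : ℝ} (hs : 0 < s)
    {r R : ℝ} (hr : 0 ≤ r) (hrR : r ≤ R) : Real.circleAverage (fun z => ‖f z‖ ^ s) 0 r ≤
      Real.circleAverage (fun z => ‖f z‖ ^ s) 0 R := by
  set h : ℝ → ℝ := fun x => Real.circleAverage (fun z => ‖f z‖ ^ s) 0 x with hh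
  have hcont : Continuous h := Real.Continuous.circleAverage (continuous_norm_rpow hf.continuous hs)
  obtain ⟨x₁, hx₁, hmax⟩ := isCompact_Icc.exists_isMaxOn (⟨r, hr, hrR⟩ : (Icc 0 R).Nonempty)
    hcont.continuousOn
  -- the largest radius at which the maximum over `[0, R]` is attained
  obtain ⟨x, ⟨hx, hxm⟩, hxg⟩ := (isCompact_Icc.inter_right
    (isClosed_singleton (x := h x₁) |>.preimage hcont)).exists_isGreatest ⟨x₁, hx₁, rfl⟩
  have hxm' : h x = h x₁ := hxm
  rcases hx.2.eq_or_lt with hxR | hxR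
  · subst hxR
    exact (hmax ⟨hr, hrR⟩).trans_eq hxm'.symm
  exfalso
  have hlt : h R < h x₁ := by
    refine lt_of_le_of_ne (hmax ⟨hr.trans hrR, le_rfl⟩) fun he => ?_
    exact (hxg ⟨⟨hr.trans hrR, le_rfl⟩, he⟩).not_gt hxR
  have hsub := circleAverage_norm_rpow_submean hf hs x (R - x) hx.1
  change h x ≤ Real.circleAverage (fun z => h ‖z‖) x (R - x) at hsub
  have hb : ∀ θ, h ‖circleMap x (R - x) θ‖ ≤ h x₁ := fun θ => by
    refine hmax ⟨norm_nonneg _, ?_⟩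
    calc ‖circleMap x (R - x) θ‖ ≤ ‖(x : ℂ)‖ + ‖circleMap 0 (R - x) θ‖ := by
          rw [← circleMap_sub_center (x : ℂ) (R - x) θ]
          exact norm_le_norm_add_norm_sub' _ _
      _ = R := by
          simp [abs_of_nonneg hx.1, abs_of_pos (sub_pos.2 hxR)]
  have hcc : Continuous fun θ => h ‖circleMap x (R - x) θ‖ :=
    hcont.comp (continuous_circleMap _ _).norm
  have hpos : 0 < ∫ θ in (0 : ℝ)..2 * Real.pi, (h x₁ - h ‖circleMap x (R - x) θ‖) := by
    refine intervalIntegral.integral_pos (by positivity) (by fun_prop)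
      (fun θ _ => sub_nonneg.2 (hb θ)) ⟨0, ⟨le_rfl, by positivity⟩, ?_⟩
    have : circleMap (x : ℂ) (R - x) 0 = (R : ℂ) := by simp [circleMap]
    rw [this, Complex.norm_real, Real.norm_of_nonneg (hr.trans hrR)]
    exact sub_pos.2 hlt
  rw [intervalIntegral.integral_sub (by simp) (hcc.intervalIntegrable _ _)] at hpos
  rw [Real.circleAverage, hxm', smul_eq_mul, inv_mul_eq_div, le_div_iff₀ (by positivity)] at hsub
  simp only [intervalIntegral.integral_const, smul_eq_mul, sub_zero] at hpos
  linarith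

/-- The unnormalised circular mean `∫_0^{2π} F(r e^{iθ}) dθ`. -/
def circleLIntegral (F : ℂ → ℝ≥0∞) (r : ℝ) : ℝ≥0∞ :=
  ∫⁻ θ in Ioc (0 : ℝ) (2 * Real.pi), F ((r : ℂ) * Complex.exp ((θ : ℂ) * Complex.I))

lemma enorm_rpow_eq_ofReal (z : ℂ) {s : ℝ} (hs : 0 < s) :
    ‖z‖ₑ ^ s = ENNReal.ofReal (‖z‖ ^ s) := by
  rw [← ofReal_norm, ENNReal.ofReal_rpow_of_nonneg (norm_nonneg _) hs.le]

lemma lintegral_circle_eq_ofReal_circleAverage {f : ℂ → ℂ} (hf : Continuous f) {s : ℝ} (hs : 0 < s)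
    (c : ℂ) (r : ℝ) :
    ∫⁻ θ in Ioc (0 : ℝ) (2 * Real.pi), ‖f (circleMap c r θ)‖ₑ ^ s =
      ENNReal.ofReal (2 * Real.pi * Real.circleAverage (fun z => ‖f z‖ ^ s) c r) := by
  have hc : Continuous fun θ => ‖f (circleMap c r θ)‖ ^ s :=
    (continuous_norm_rpow hf hs).comp (continuous_circleMap c r)
  rw [Real.circleAverage, smul_eq_mul, mul_inv_cancel_left₀ (by positivity),
    intervalIntegral.integral_of_le (by positivity),
    ofReal_integral_eq_lintegral_ofReal (hc.integrableOn_Ioc)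
      (Filter.Eventually.of_forall fun θ => by positivity)]
  simp_rw [enorm_rpow_eq_ofReal _ hs]

lemma circleLIntegral_eq_ofReal_circleAverage {f : ℂ → ℂ} (hf : Continuous f) {s : ℝ} (hs : 0 < s)
    (r : ℝ) : circleLIntegral (fun z => ‖f z‖ₑ ^ s) r =
      ENNReal.ofReal (2 * Real.pi * Real.circleAverage (fun z => ‖f z‖ ^ s) 0 r) := by
  rw [← lintegral_circle_eq_ofReal_circleAverage hf hs]
  simp only [circleLIntegral, circleMap, zero_add]

lemma circleLIntegral_mono {f : ℂ → ℂ} (hf : Differentiable ℂ f) {s : ℝ} (hs : 0 < s)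
    {r R : ℝ} (hr : 0 ≤ r) (hrR : r ≤ R) :
    circleLIntegral (fun z => ‖f z‖ₑ ^ s) r ≤ circleLIntegral (fun z => ‖f z‖ₑ ^ s) R := by
  simp only [circleLIntegral_eq_ofReal_circleAverage hf.continuous hs]
  gcongr
  exact circleAverage_norm_rpow_mono hf hs hr hrR

lemma lintegral_comp_mul_exp {f : ℂ → ℂ} (hf : Continuous f) {s : ℝ} (hs : 0 < s) (c : ℂ) :
    ∫⁻ θ in Ioc (0 : ℝ) (2 * Real.pi), ‖f (c * Complex.exp ((θ : ℂ) * Complex.I))‖ₑ ^ s =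
      circleLIntegral (fun z => ‖f z‖ₑ ^ s) ‖c‖ := by
  rw [circleLIntegral_eq_ofReal_circleAverage hf hs, ← circleAverage_comp_mul_exp,
    ← lintegral_circle_eq_ofReal_circleAverage (f := fun z => f (c * z)) (by fun_prop) hs]
  simp only [circleMap, zero_add, Complex.ofReal_one, one_mul]

lemma setLIntegral_ball_comp_mul_exp (F : ℂ → ℝ≥0∞) (δ θ : ℝ) :
    ∫⁻ w in Metric.ball (0 : ℂ) δ, F (w * Complex.exp ((θ : ℂ) * Complex.I)) =
      ∫⁻ w in Metric.ball (0 : ℂ) δ, F w := by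
  have hmp := (rotation (Circle.exp θ)).measurePreserving
  have := hmp.setLIntegral_comp_preimage_emb
    (rotation (Circle.exp θ)).toHomeomorph.measurableEmbedding F (Metric.ball 0 δ)
  rw [← this]
  have hpre : (rotation (Circle.exp θ)) ⁻¹' Metric.ball 0 δ = Metric.ball 0 δ := by
    ext w
    simp only [mem_preimage, mem_ball_zero_iff, LinearIsometryEquiv.norm_map]
  rw [hpre]
  simp [rotation_apply, mul_comm]

/-- The sub-mean value property of `|f|^s` over discs. -/
lemma enorm_rpow_mul_volume_le {f : ℂ → ℂ} (hf : Differentiable ℂ f) {s : ℝ} (hs : 0 < s)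
    (c : ℂ) (δ : ℝ) : ‖f c‖ₑ ^ s * volume (Metric.ball (0 : ℂ) δ) ≤
      ∫⁻ w in Metric.ball (0 : ℂ) δ, ‖f (c + w)‖ₑ ^ s := by
  set E : ℝ → ℂ := fun θ => Complex.exp ((θ : ℂ) * Complex.I) with hE
  have hpi : (0 : ℝ) < 2 * Real.pi := by positivity
  have hm : Measurable (Function.uncurry fun (θ : ℝ) (w : ℂ) => ‖f (c + w * E θ)‖ₑ ^ s) :=
    (Continuous.measurable (by have := hf.continuous; fun_prop)).pow_const s
  have h1 : ∫⁻ θ in Ioc (0 : ℝ) (2 * Real.pi), ∫⁻ w in Metric.ball (0 : ℂ) δ,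
      ‖f (c + w * E θ)‖ₑ ^ s = ENNReal.ofReal (2 * Real.pi) *
        ∫⁻ w in Metric.ball (0 : ℂ) δ, ‖f (c + w)‖ₑ ^ s := by
    simp_rw [hE, setLIntegral_ball_comp_mul_exp (fun w => ‖f (c + w)‖ₑ ^ s)]
    simp [mul_comm]
  have h2 : ∀ w : ℂ, ENNReal.ofReal (2 * Real.pi) * ‖f c‖ₑ ^ s ≤
      ∫⁻ θ in Ioc (0 : ℝ) (2 * Real.pi), ‖f (c + w * E θ)‖ₑ ^ s := fun w => by
    have h3 := lintegral_circle_eq_ofReal_circleAverage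
      (f := fun z => f (c + w * z)) (by have := hf.continuous; fun_prop) hs 0 1
    have h4 := norm_rpow_le_circleAverage (f := fun z => f (c + w * z)) (by fun_prop) hs 0 1
    simp only [circleMap, zero_add, Complex.ofReal_one, one_mul] at h3
    rw [hE, h3, enorm_rpow_eq_ofReal _ hs, ← ENNReal.ofReal_mul hpi.le]
    gcongr
    simpa using h4
  have h5 : ENNReal.ofReal (2 * Real.pi) * (‖f c‖ₑ ^ s * volume (Metric.ball (0 : ℂ) δ)) ≤
      ENNReal.ofReal (2 * Real.pi) * ∫⁻ w in Metric.ball (0 : ℂ) δ, ‖f (c + w)‖ₑ ^ s := by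
    rw [← h1, lintegral_lintegral_swap hm.aemeasurable, ← mul_assoc, ← setLIntegral_const]
    exact lintegral_mono h2
  exact (ENNReal.mul_le_mul_iff_right (by simpa using Real.pi_pos) ENNReal.ofReal_ne_top).1 h5

/-- A local maximal inequality: if the radial segments are at most half as long as their distance
to a larger circle, the supremum of `|f|^s` over them is controlled by the mean over that circle. -/
lemma lintegral_iSup_Icc_le {f : ℂ → ℂ} (hf : Differentiable ℂ f) {s : ℝ} (hs : 0 < s)
    {a b c : ℝ} (hb : 0 ≤ b) (hbc : b < c) (habc : 3 * b - 2 * a ≤ c) :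
    ∫⁻ θ in Ioc (0 : ℝ) (2 * Real.pi), ⨆ x ∈ Icc a b,
      ‖f ((x : ℂ) * Complex.exp ((θ : ℂ) * Complex.I))‖ₑ ^ s ≤
        4 * circleLIntegral (fun z => ‖f z‖ₑ ^ s) c := by
  set E : ℝ → ℂ := fun θ => Complex.exp ((θ : ℂ) * Complex.I) with hE
  have hE1 : ∀ θ, ‖E θ‖ = 1 := fun θ => Complex.norm_exp_ofReal_mul_I θ
  -- discs of radius `δ` centred on the segment lie in the disc of radius `2 * δ` about its endpoint
  set δ := (c - b) / 2 with hδ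
  have hδ0 : 0 < δ := by rw [hδ]; linarith
  set V := volume (Metric.ball (0 : ℂ) δ) with hV
  have hV0 : V ≠ 0 := (Metric.measure_ball_pos _ _ hδ0).ne'
  have hVt : V ≠ ∞ := measure_ball_lt_top.ne
  have hV2 : volume (Metric.ball (0 : ℂ) (2 * δ)) = 4 * V := by
    rw [hV, Complex.volume_ball, Complex.volume_ball, ENNReal.ofReal_mul (by norm_num), mul_pow,
      ← mul_assoc]
    norm_num
  have hm : Measurable (Function.uncurry fun (θ : ℝ) (w : ℂ) => ‖f ((b + w) * E θ)‖ₑ ^ s) :=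
    (Continuous.measurable (by have := hf.continuous; fun_prop)).pow_const s
  have h1 : ∀ θ : ℝ, (⨆ x ∈ Icc a b, ‖f (x * E θ)‖ₑ ^ s) * V ≤
      ∫⁻ w in Metric.ball (0 : ℂ) (2 * δ), ‖f ((b + w) * E θ)‖ₑ ^ s := fun θ => by
    simp_rw [ENNReal.iSup_mul]
    refine iSup₂_le fun x hx => (enorm_rpow_mul_volume_le hf hs _ δ).trans ?_
    calc ∫⁻ w in Metric.ball (0 : ℂ) δ, ‖f (x * E θ + w)‖ₑ ^ s
        = ∫⁻ w in Metric.ball (0 : ℂ) δ, ‖f ((x + w) * E θ)‖ₑ ^ s := by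
          rw [← setLIntegral_ball_comp_mul_exp (fun w => ‖f (x * E θ + w)‖ₑ ^ s) δ θ]
          simp_rw [hE, add_mul]
      _ = ∫⁻ w in (fun w : ℂ => w + ((x : ℂ) - b)) ⁻¹' Metric.ball ((x : ℂ) - b) δ,
            ‖f ((b + (w + ((x : ℂ) - b))) * E θ)‖ₑ ^ s := by
          congr 2
          · ext w; simp
          · ext w; congr 4; ring
      _ = ∫⁻ w in Metric.ball ((x : ℂ) - b) δ, ‖f ((b + w) * E θ)‖ₑ ^ s :=
          (measurePreserving_add_right volume ((x : ℂ) - b)).setLIntegral_comp_preimage_emb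
            (measurableEmbedding_addRight _) (fun w => ‖f ((b + w) * E θ)‖ₑ ^ s) _
      _ ≤ _ := by
          refine lintegral_mono_set (Metric.ball_subset_ball' ?_)
          rw [dist_zero_right, ← Complex.ofReal_sub, Complex.norm_real, Real.norm_eq_abs,
            abs_of_nonpos (by linarith [hx.2])]
          linarith [hx.1]
  have h2 : (∫⁻ θ in Ioc (0 : ℝ) (2 * Real.pi), ⨆ x ∈ Icc a b, ‖f (x * E θ)‖ₑ ^ s) * V ≤
      4 * circleLIntegral (fun z => ‖f z‖ₑ ^ s) c * V := by
    calc _ = ∫⁻ θ in Ioc (0 : ℝ) (2 * Real.pi), (⨆ x ∈ Icc a b, ‖f (x * E θ)‖ₑ ^ s) * V :=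
          (lintegral_mul_const' _ _ hVt).symm
      _ ≤ _ := lintegral_mono h1
      _ = ∫⁻ w in Metric.ball (0 : ℂ) (2 * δ), ∫⁻ θ in Ioc (0 : ℝ) (2 * Real.pi),
            ‖f ((b + w) * E θ)‖ₑ ^ s := lintegral_lintegral_swap hm.aemeasurable
      _ ≤ ∫⁻ w in Metric.ball (0 : ℂ) (2 * δ), circleLIntegral (fun z => ‖f z‖ₑ ^ s) c := by
          refine setLIntegral_mono measurable_const fun w hw => ?_
          rw [hE, lintegral_comp_mul_exp hf.continuous hs]
          refine circleLIntegral_mono hf hs (norm_nonneg _) ((norm_add_le _ _).trans ?_)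
          rw [mem_ball_zero_iff] at hw
          rw [Complex.norm_real, Real.norm_of_nonneg hb]
          linarith
      _ = _ := by rw [setLIntegral_const, hV2]; ring
  exact (ENNReal.mul_le_mul_iff_left hV0 hVt).1 h2

/-! ### Circular means and Gaussian radial norms -/

/-- The circular mean `M_p(F, r)` of a function with extended nonnegative values; for
`F z = ‖f z‖ₑ` it is definitionally `integralMean p f r`. -/
def circleMean (p : ℝ≥0∞) (F : ℂ → ℝ≥0∞) (r : ℝ) : ℝ≥0∞ :=
  if p = ∞ then ⨆ (z : ℂ) (_ : ‖z‖ = r), F z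
  else (ENNReal.ofReal (1 / (2 * Real.pi)) *
    circleLIntegral (fun z => F z ^ p.toReal) r) ^ (1 / p.toReal)

/-- The Gaussian radial (quasi-)norm which turns circular means into the mixed Fock norm. -/
def radialNorm (q : ℝ≥0∞) (α : ℝ) (N : ℝ → ℝ≥0∞) : ℝ≥0∞ :=
  if q = ∞ then
    ⨆ (r : ℝ) (_ : 0 ≤ r), N r * ENNReal.ofReal (Real.exp (-(α / 2) * r ^ 2))
  else (ENNReal.ofReal (α * q.toReal) *
    ∫⁻ r in Ioi (0 : ℝ), N r ^ q.toReal *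
      ENNReal.ofReal (Real.exp (-(α * q.toReal / 2) * r ^ 2) * r)) ^ (1 / q.toReal)

/-- The mixed Fock norm of a function with extended nonnegative values. -/
def mixedNorm (p q : ℝ≥0∞) (α : ℝ) (F : ℂ → ℝ≥0∞) : ℝ≥0∞ :=
  radialNorm q α (circleMean p F)

lemma fockNorm_eq_mixedNorm (p q : ℝ≥0∞) (α : ℝ) (f : ℂ → ℂ) :
    fockNorm p q α f = mixedNorm p q α fun z => ‖f z‖ₑ := rfl

variable {p q : ℝ≥0∞} {α : ℝ}

lemma circleMean_mono_of_sphere {F G : ℂ → ℝ≥0∞} {r r' : ℝ} 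
    (h : ∀ u : ℂ, ‖u‖ = 1 → F (r * u) ≤ G (r' * u)) (hr' : 0 ≤ r') :
    circleMean p F r ≤ circleMean p G r' := by
  unfold circleMean
  split_ifs with hp
  · refine iSup₂_le fun z hz => ?_
    have hu : ‖Complex.exp (Complex.arg z * Complex.I)‖ = 1 := Complex.norm_exp_ofReal_mul_I _
    have := h _ hu
    rw [← hz, Complex.norm_mul_exp_arg_mul_I] at this
    refine this.trans (le_iSup₂ (f := fun (z : ℂ) (_ : ‖z‖ = r') => G z) _ ?_)
    rw [norm_mul, hu, mul_one, Complex.norm_real, Real.norm_of_nonneg hr']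
  · refine ENNReal.rpow_le_rpow ?_ (by positivity)
    gcongr
    refine lintegral_mono fun θ => ?_
    exact ENNReal.rpow_le_rpow (h _ (Complex.norm_exp_ofReal_mul_I θ)) (by positivity)

lemma circleMean_mono {F G : ℂ → ℝ≥0∞} {r : ℝ} (hr : 0 ≤ r) (h : ∀ z, ‖z‖ = r → F z ≤ G z) :
    circleMean p F r ≤ circleMean p G r :=
  circleMean_mono_of_sphere (fun u hu => h _ (by simp [hu, abs_of_nonneg hr])) hr

lemma circleMean_const_le (hp : 0 < p) (c : ℝ≥0∞) (r : ℝ) : circleMean p (fun _ => c) r ≤ c := by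
  unfold circleMean
  split_ifs with hpt
  · exact iSup₂_le fun _ _ => le_rfl
  · have hp' := ENNReal.toReal_pos hp.ne' hpt
    have : ENNReal.ofReal (1 / (2 * Real.pi)) * (c ^ p.toReal * ENNReal.ofReal (2 * Real.pi)) =
        c ^ p.toReal := by
      rw [mul_left_comm, ← ENNReal.ofReal_mul (by positivity), one_div_mul_cancel (by positivity),
        ENNReal.ofReal_one, mul_one]
    simp only [circleLIntegral, setLIntegral_const, Real.volume_Ioc, sub_zero]
    rw [this, ← ENNReal.rpow_mul, mul_one_div_cancel hp'.ne', ENNReal.rpow_one]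

lemma circleMean_const_mul (hp : 0 < p) {c : ℝ≥0∞} (hc : c ≠ ∞) (F : ℂ → ℝ≥0∞) (r : ℝ) :
    circleMean p (fun z => c * F z) r = c * circleMean p F r := by
  unfold circleMean
  split_ifs with hpt
  · simp only [ENNReal.mul_iSup]
  · have := rpow_lintegral_const_mul (volume.restrict (Ioc (0 : ℝ) (2 * Real.pi)))
      (ENNReal.toReal_pos hp.ne' hpt) (ENNReal.ofReal (1 / (2 * Real.pi))) c hc
      (fun θ : ℝ => F ((r : ℂ) * Complex.exp ((θ : ℂ) * Complex.I))) (fun _ => 1)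
    simpa only [mul_one, circleLIntegral] using this

lemma circleMean_max_le (hp : 0 < p) {F G : ℂ → ℝ≥0∞} (hF : Measurable F) (r : ℝ) :
    circleMean p (fun z => max (F z) (G z)) r ≤
      quasiConst p * max (circleMean p F r) (circleMean p G r) := by
  unfold circleMean
  split_ifs with hpt
  · simp only [hpt, quasiConst, ENNReal.toReal_top, div_zero, ENNReal.rpow_zero, one_mul]
    refine iSup₂_le fun z hz => max_le_max ?_ ?_
    · exact le_iSup₂ (f := fun (z : ℂ) (_ : ‖z‖ = r) => F z) z hz
    · exact le_iSup₂ (f := fun (z : ℂ) (_ : ‖z‖ = r) => G z) z hz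
  · have := rpow_lintegral_le_max (volume.restrict (Ioc (0 : ℝ) (2 * Real.pi)))
      (ENNReal.toReal_pos hp.ne' hpt) (ENNReal.ofReal (1 / (2 * Real.pi))) 1 (by simp)
      (fun θ : ℝ => F ((r : ℂ) * Complex.exp ((θ : ℂ) * Complex.I)))
      (fun θ : ℝ => G ((r : ℂ) * Complex.exp ((θ : ℂ) * Complex.I))) _
      (fun _ => 1) (hF.comp (Continuous.measurable (by fun_prop))) measurable_const
      (fun θ => (one_mul _).ge)
    simpa only [mul_one, one_mul, quasiConst, circleLIntegral] using this

lemma radialNorm_mono {N N' : ℝ → ℝ≥0∞} (h : ∀ r, 0 ≤ r → N r ≤ N' r) :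
    radialNorm q α N ≤ radialNorm q α N' := by
  unfold radialNorm
  split_ifs with hq
  · refine iSup₂_le fun r hr => le_iSup₂_of_le r hr ?_
    gcongr
    exact h r hr
  · refine ENNReal.rpow_le_rpow ?_ (by positivity)
    gcongr ENNReal.ofReal (α * q.toReal) * ?_
    refine setLIntegral_mono' measurableSet_Ioi fun r hr => ?_
    gcongr
    exact h r (le_of_lt hr)

lemma radialNorm_const_mul (hq : 0 < q) {c : ℝ≥0∞} (hc : c ≠ ∞) (N : ℝ → ℝ≥0∞) :
    radialNorm q α (fun r => c * N r) = c * radialNorm q α N := by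
  unfold radialNorm
  split_ifs with hqt
  · simp only [ENNReal.mul_iSup, mul_assoc]
  · exact rpow_lintegral_const_mul _ (ENNReal.toReal_pos hq.ne' hqt) _ _ hc _ _

lemma radialNorm_max_le (hq : 0 < q) {N N' : ℝ → ℝ≥0∞} (hN : MonotoneOn N (Ici 0)) :
    radialNorm q α (fun r => max (N r) (N' r)) ≤
      quasiConst q * max (radialNorm q α N) (radialNorm q α N') := by
  unfold radialNorm
  split_ifs with hqt
  · simp only [hqt, quasiConst, ENNReal.toReal_top, div_zero, ENNReal.rpow_zero, one_mul]
    refine iSup₂_le fun r hr => ?_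
    rw [max_mul_of_nonneg _ _ zero_le]
    refine max_le_max ?_ ?_
    · exact le_iSup₂ (f := fun (r : ℝ) (_ : 0 ≤ r) =>
        N r * ENNReal.ofReal (Real.exp (-(α / 2) * r ^ 2))) r hr
    · exact le_iSup₂ (f := fun (r : ℝ) (_ : 0 ≤ r) =>
        N' r * ENNReal.ofReal (Real.exp (-(α / 2) * r ^ 2))) r hr
  · -- extend `N` constantly to the left of `0` to get a monotone, hence measurable, function
    have hm : Measurable fun r : ℝ => N (max r 0) :=
      Monotone.measurable fun x y hxy =>
        hN (mem_Ici.2 (le_max_right _ _)) (mem_Ici.2 (le_max_right _ _)) (max_le_max_right 0 hxy)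
    have he : ∀ φ : ℝ → ℝ≥0∞, ∫⁻ r in Ioi (0 : ℝ), N r ^ q.toReal * φ r =
        ∫⁻ r in Ioi (0 : ℝ), N (max r 0) ^ q.toReal * φ r := fun φ =>
      setLIntegral_congr_fun measurableSet_Ioi fun r hr => by
        simp only [max_eq_left (le_of_lt (mem_Ioi.1 hr))]
    have he' : ∀ φ : ℝ → ℝ≥0∞, ∫⁻ r in Ioi (0 : ℝ), max (N r) (N' r) ^ q.toReal * φ r =
        ∫⁻ r in Ioi (0 : ℝ), max (N (max r 0)) (N' r) ^ q.toReal * φ r := fun φ =>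
      setLIntegral_congr_fun measurableSet_Ioi fun r hr => by
        simp only [max_eq_left (le_of_lt (mem_Ioi.1 hr))]
    rw [he, he']
    have := rpow_lintegral_le_max (volume.restrict (Ioi (0 : ℝ)))
      (ENNReal.toReal_pos hq.ne' hqt) (ENNReal.ofReal (α * q.toReal)) 1 (by simp)
      (fun r => N (max r 0)) N' _
      (fun r : ℝ => ENNReal.ofReal (Real.exp (-(α * q.toReal / 2) * r ^ 2) * r))
      hm (by fun_prop) (fun r => (one_mul _).ge)
    simpa only [one_mul, quasiConst] using this

lemma lintegral_gaussian_lt_top {b : ℝ} (hb : 0 < b) :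
    ∫⁻ r in Ioi (0 : ℝ), ENNReal.ofReal (Real.exp (-b * r ^ 2) * r) < ∞ := by
  have := (integrable_mul_exp_neg_mul_sq hb).integrableOn (s := Ioi 0)
  refine lt_of_le_of_lt (lintegral_mono fun r => ?_) this.2
  rw [mul_comm, ← ofReal_norm]
  exact ENNReal.ofReal_le_ofReal (Real.le_norm_self _)

/-- The profile `e^{α r² / 4}` has finite norm; it serves as a majorant of constants and powers. -/
lemma radialNorm_exp_lt_top (hq : 0 < q) (hα : 0 < α) :
    radialNorm q α (fun r => ENNReal.ofReal (Real.exp (α / 4 * r ^ 2))) < ∞ := by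
  unfold radialNorm
  split_ifs with hqt
  · refine lt_of_le_of_lt (iSup₂_le fun r hr => ?_) ENNReal.one_lt_top
    rw [← ENNReal.ofReal_mul (Real.exp_nonneg _), ← Real.exp_add, ENNReal.ofReal_le_one,
      Real.exp_le_one_iff]
    nlinarith [mul_nonneg hα.le (sq_nonneg r)]
  · have hq' := ENNReal.toReal_pos hq.ne' hqt
    refine ENNReal.rpow_lt_top_of_nonneg (by positivity)
      (ENNReal.mul_lt_top ENNReal.ofReal_lt_top ?_).ne
    refine lt_of_eq_of_lt (setLIntegral_congr_fun measurableSet_Ioi fun r _ => ?_)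
      (lintegral_gaussian_lt_top (b := α * q.toReal / 4) (by positivity))
    simp only
    rw [ENNReal.ofReal_rpow_of_nonneg (Real.exp_nonneg _) hq'.le,
      ← ENNReal.ofReal_mul (by positivity), ← Real.exp_mul, ← mul_assoc, ← Real.exp_add]
    congr 3; ring

lemma radialNorm_const_le (hq : 0 < q) (hα : 0 < α) :
    ∃ C : ℝ≥0∞, C ≠ ∞ ∧ ∀ c : ℝ≥0∞, c ≠ ∞ → radialNorm q α (fun _ => c) ≤ C * c := by
  refine ⟨_, (radialNorm_exp_lt_top hq hα).ne, fun c hc => ?_⟩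
  rw [mul_comm, ← radialNorm_const_mul hq hc]
  refine radialNorm_mono fun r _ => ?_
  calc c = c * ENNReal.ofReal 1 := by simp
    _ ≤ _ := by gcongr; exact Real.one_le_exp (by positivity)

/-- Evaluation of a monotone profile is controlled by its radial norm. -/
lemma le_mul_radialNorm (hq : 0 < q) (hα : 0 < α) {ρ : ℝ} (hρ : 0 ≤ ρ) :
    ∃ C : ℝ≥0∞, C ≠ ∞ ∧ ∀ N : ℝ → ℝ≥0∞, MonotoneOn N (Ici 0) → N ρ ≤ C * radialNorm q α N := by
  -- the norm of the indicator of `[ρ, ∞)` is positive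
  set w := radialNorm q α (fun r => if ρ ≤ r then 1 else 0) with hw
  have hw0 : w ≠ 0 := by
    rw [hw]
    unfold radialNorm
    split_ifs with hqt
    · intro h0
      simp only [ENNReal.iSup_eq_zero] at h0
      have := h0 ρ hρ
      simp only [le_refl, if_true, one_mul, ENNReal.ofReal_eq_zero] at this
      exact this.not_gt (Real.exp_pos _)
    · have hq' := ENNReal.toReal_pos hq.ne' hqt
      have : ∫⁻ r in Ioi (0 : ℝ), (if ρ ≤ r then (1 : ℝ≥0∞) else 0) ^ q.toReal *
          ENNReal.ofReal (Real.exp (-(α * q.toReal / 2) * r ^ 2) * r) ≠ 0 := by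
        intro h0
        have h1 : ∫⁻ r in Ioi ρ,
            ENNReal.ofReal (Real.exp (-(α * q.toReal / 2) * r ^ 2) * r) = 0 := by
          refine le_antisymm (le_trans ?_ h0.le) zero_le
          refine le_trans ?_ (lintegral_mono_set (Ioi_subset_Ioi hρ))
          refine setLIntegral_mono' measurableSet_Ioi fun r hr => ?_
          simp [le_of_lt (mem_Ioi.1 hr)]
        rw [lintegral_eq_zero_iff (by fun_prop)] at h1
        have h2 := (ae_restrict_iff' measurableSet_Ioi).1 h1
        have h3 : Ioi ρ ⊆ {r | ¬ (r ∈ Ioi ρ → ENNReal.ofReal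
            (Real.exp (-(α * q.toReal / 2) * r ^ 2) * r) = (0 : ℝ → ℝ≥0∞) r)} := fun r hr => by
          have : 0 < r := hρ.trans_lt hr
          simp only [mem_ofPred_eq, Pi.zero_apply, ENNReal.ofReal_eq_zero, not_forall, not_le]
          exact ⟨hr, by positivity⟩
        have h4 := measure_mono_null h3 h2
        simp at h4
      rw [Ne, ENNReal.rpow_eq_zero_iff]
      simp only [mul_eq_zero, this, ENNReal.ofReal_eq_zero, not_le.2 (mul_pos hα hq'), or_self,
        false_and, false_or, not_and, not_lt]
      intro _; positivity
  refine ⟨w⁻¹, ENNReal.inv_ne_top.2 hw0, fun N hN => ?_⟩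
  have hwt : w ≠ ∞ := by
    refine (lt_of_le_of_lt (radialNorm_mono fun r _ => ?_) (radialNorm_exp_lt_top hq hα)).ne
    split_ifs
    · rw [ENNReal.one_le_ofReal]; exact Real.one_le_exp (by positivity)
    · exact zero_le
  refine ENNReal.le_of_forall_nnreal_lt fun c hc => ?_
  have h1 : c * w ≤ radialNorm q α N := by
    rw [hw, ← radialNorm_const_mul hq ENNReal.coe_ne_top]
    refine radialNorm_mono fun r hr => ?_
    split_ifs with h
    · rw [mul_one]
      exact hc.le.trans (hN (mem_Ici.2 hρ) (mem_Ici.2 hr) h)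
    · simp
  rw [mul_comm, ← div_eq_mul_inv]
  exact (ENNReal.le_div_iff_mul_le (Or.inl hw0) (Or.inl hwt)).2 h1

/-! ### Shifts and dilations of radial profiles -/

lemma hasDerivAt_sqrt_sq_add {c r : ℝ} (h : 0 < r ^ 2 + c) :
    HasDerivAt (fun r : ℝ => √(r ^ 2 + c)) (r / √(r ^ 2 + c)) r := by
  have h1 : HasDerivAt (fun r : ℝ => r ^ 2 + c) (2 * r) r := by
    simpa using (hasDerivAt_pow 2 r).add_const c
  convert h1.sqrt h.ne' using 1
  field_simp

/-- The substitution `s² = r² + c`. -/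
lemma setLIntegral_comp_sqrt_le {k c : ℝ} (hk : 0 ≤ k) (hkc : 0 < k + c) (φ : ℝ → ℝ≥0∞) :
    ∫⁻ r in Ici √k, φ √(r ^ 2 + c) * ENNReal.ofReal r ≤
      ∫⁻ s in Ioi (0 : ℝ), φ s * ENNReal.ofReal s := by
  have hpos : ∀ r ∈ Ici √k, 0 < r ^ 2 + c := fun r hr => by
    have := Real.sq_sqrt hk
    nlinarith [Real.sqrt_nonneg k, mem_Ici.1 hr]
  have h0 : ∀ r ∈ Ici √k, 0 ≤ r := fun r hr => (Real.sqrt_nonneg k).trans hr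
  have hinj : InjOn (fun r : ℝ => √(r ^ 2 + c)) (Ici √k) := fun x hx y hy hxy => by
    have := (Real.sqrt_inj (hpos x hx).le (hpos y hy).le).1 hxy
    exact (pow_left_inj₀ (h0 x hx) (h0 y hy) two_ne_zero).1 (by linarith)
  have hcv := lintegral_image_eq_lintegral_abs_deriv_mul measurableSet_Ici
    (fun r hr => (hasDerivAt_sqrt_sq_add (hpos r hr)).hasDerivWithinAt) hinj
    (fun s => φ s * ENNReal.ofReal s)
  have hsub : (fun r : ℝ => √(r ^ 2 + c)) '' Ici √k ⊆ Ioi 0 := by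
    rintro _ ⟨r, hr, rfl⟩
    exact Real.sqrt_pos.2 (hpos r hr)
  refine le_trans (le_of_eq ?_) (lintegral_mono_set hsub)
  rw [hcv]
  refine setLIntegral_congr_fun measurableSet_Ici fun r hr => ?_
  have hs := Real.sqrt_pos.2 (hpos r hr)
  rw [mul_left_comm, ← ENNReal.ofReal_mul (abs_nonneg _), abs_of_nonneg (by
    have := h0 r hr; positivity), div_mul_cancel₀ _ hs.ne']

lemma tsum_ofReal_exp_lt_top {b : ℝ} (hb : 0 < b) :
    ∑' k : ℕ, ENNReal.ofReal (Real.exp (-b * k)) < ∞ := by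
  have : ∀ k : ℕ, ENNReal.ofReal (Real.exp (-b * k)) = ENNReal.ofReal (Real.exp (-b)) ^ k :=
    fun k => by rw [← ENNReal.ofReal_pow (Real.exp_nonneg _), ← Real.exp_nat_mul, mul_comm]
  simp_rw [this]
  rw [ENNReal.tsum_geometric, ENNReal.inv_lt_top, tsub_pos_iff_lt, ENNReal.ofReal_lt_one,
    Real.exp_lt_one_iff]
  linarith

/-- Shifting the square of the radius by `k` gains the factor `e^{-α k / 2}` in the Gaussian weight,
so a pointwise domination with loss only `e^{α k / 4}` is a domination of norms. -/
lemma radialNorm_le_of_shift (hq : 0 < q) (hα : 0 < α) {A : ℝ≥0∞} (hA : A ≠ ∞) :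
    ∃ C : ℝ≥0∞, C ≠ ∞ ∧ ∀ N n : ℝ → ℝ≥0∞, Measurable n →
      (∀ r, 0 ≤ r → ∃ k : ℕ, (k : ℝ) ≤ r ^ 2 ∧
        N r ≤ A * ENNReal.ofReal (Real.exp (α / 4 * k)) * n √(r ^ 2 + (8 - k))) →
      radialNorm q α N ≤ C * radialNorm q α n := by
  by_cases hqt : q = ∞
  · refine ⟨A * ENNReal.ofReal (Real.exp (4 * α)), ENNReal.mul_ne_top hA ENNReal.ofReal_ne_top,
      fun N n _ h => ?_⟩
    simp only [radialNorm, hqt, if_true]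
    refine iSup₂_le fun r hr => ?_
    obtain ⟨k, hk, hN⟩ := h r hr
    set s := √(r ^ 2 + (8 - k)) with hs
    have hs2 : s ^ 2 = r ^ 2 + (8 - k) := Real.sq_sqrt (by linarith)
    calc N r * ENNReal.ofReal (Real.exp (-(α / 2) * r ^ 2))
        ≤ A * ENNReal.ofReal (Real.exp (α / 4 * k)) * n s *
          ENNReal.ofReal (Real.exp (-(α / 2) * r ^ 2)) := by gcongr
      _ = A * n s * ENNReal.ofReal (Real.exp (α / 4 * k + -(α / 2) * r ^ 2)) := by
          rw [Real.exp_add, ENNReal.ofReal_mul (Real.exp_nonneg _)]; ring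
      _ ≤ A * n s * ENNReal.ofReal (Real.exp (4 * α + -(α / 2) * s ^ 2)) := by
          refine mul_le_mul' le_rfl (ENNReal.ofReal_le_ofReal (Real.exp_le_exp.2 ?_))
          rw [hs2]
          nlinarith [mul_nonneg hα.le (Nat.cast_nonneg (α := ℝ) k)]
      _ = A * ENNReal.ofReal (Real.exp (4 * α)) *
          (n s * ENNReal.ofReal (Real.exp (-(α / 2) * s ^ 2))) := by
          rw [Real.exp_add, ENNReal.ofReal_mul (Real.exp_nonneg _)]; ring
      _ ≤ _ := by
          gcongr
          exact le_iSup₂ (f := fun (r : ℝ) (_ : 0 ≤ r) =>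
            n r * ENNReal.ofReal (Real.exp (-(α / 2) * r ^ 2))) s (Real.sqrt_nonneg _)
  · set Q := q.toReal with hQ
    have hQ0 : 0 < Q := ENNReal.toReal_pos hq.ne' hqt
    have hb : 0 < α * Q / 4 := by positivity
    set S := ∑' k : ℕ, ENNReal.ofReal (Real.exp (-(α * Q / 4) * k)) with hS
    set K := A ^ Q * ENNReal.ofReal (Real.exp (4 * α * Q)) with hK
    have hKt : K ≠ ∞ := ENNReal.mul_ne_top (ENNReal.rpow_ne_top_of_nonneg hQ0.le hA)
      ENNReal.ofReal_ne_top
    refine ⟨(K * S) ^ (1 / Q), ENNReal.rpow_ne_top_of_nonneg (by positivity)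
      (ENNReal.mul_ne_top hKt (tsum_ofReal_exp_lt_top hb).ne), fun N n hn h => ?_⟩
    simp only [radialNorm, hqt, if_false]
    set φ : ℝ → ℝ≥0∞ := fun s => n s ^ Q * ENNReal.ofReal (Real.exp (-(α * Q / 2) * s ^ 2)) with hφ
    have hφm : Measurable φ := (hn.pow_const Q).mul (by fun_prop)
    set J := ∫⁻ s in Ioi (0 : ℝ), φ s * ENNReal.ofReal s with hJ
    have hw : ∀ r : ℝ, ENNReal.ofReal (Real.exp (-(α * Q / 2) * r ^ 2) * r) =
        ENNReal.ofReal (Real.exp (-(α * Q / 2) * r ^ 2)) * ENNReal.ofReal r := fun r =>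
      ENNReal.ofReal_mul (Real.exp_nonneg _)
    have hJ' : ∫⁻ r in Ioi (0 : ℝ), n r ^ Q * ENNReal.ofReal (Real.exp (-(α * Q / 2) * r ^ 2) * r) =
        J := by simp_rw [hw, ← mul_assoc]; rfl
    have hpt : ∀ r ∈ Ioi (0 : ℝ), N r ^ Q * ENNReal.ofReal (Real.exp (-(α * Q / 2) * r ^ 2) * r) ≤
        ∑' k : ℕ, K * ENNReal.ofReal (Real.exp (-(α * Q / 4) * k)) *
          (Ici √(k : ℝ)).indicator (fun r => φ √(r ^ 2 + (8 - k)) * ENNReal.ofReal r) r := by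
      intro r hr
      obtain ⟨k, hk, hN⟩ := h r (le_of_lt hr)
      refine le_trans ?_ (ENNReal.le_tsum k)
      rw [indicator_of_mem (by exact (Real.sqrt_le_left (le_of_lt hr)).2 hk)]
      set s := √(r ^ 2 + (8 - k)) with hs
      have hs2 : s ^ 2 = r ^ 2 + (8 - k) := Real.sq_sqrt (by linarith)
      calc _ ≤ (A * ENNReal.ofReal (Real.exp (α / 4 * k)) * n s) ^ Q *
            ENNReal.ofReal (Real.exp (-(α * Q / 2) * r ^ 2) * r) := by gcongr
        _ = A ^ Q * n s ^ Q * (ENNReal.ofReal (Real.exp (α / 4 * k * Q)) *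
            ENNReal.ofReal (Real.exp (-(α * Q / 2) * r ^ 2))) * ENNReal.ofReal r := by
            rw [ENNReal.mul_rpow_of_nonneg _ _ hQ0.le, ENNReal.mul_rpow_of_nonneg _ _ hQ0.le,
              ENNReal.ofReal_rpow_of_nonneg (Real.exp_nonneg _) hQ0.le, ← Real.exp_mul, hw]
            ring
        _ = A ^ Q * n s ^ Q * (ENNReal.ofReal (Real.exp (4 * α * Q)) *
            ENNReal.ofReal (Real.exp (-(α * Q / 4) * k)) *
            ENNReal.ofReal (Real.exp (-(α * Q / 2) * s ^ 2))) * ENNReal.ofReal r := by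
            rw [← ENNReal.ofReal_mul (Real.exp_nonneg _), ← ENNReal.ofReal_mul (Real.exp_nonneg _),
              ← ENNReal.ofReal_mul (by positivity), ← Real.exp_add, ← Real.exp_add,
              ← Real.exp_add, hs2]
            congr 4
            ring
        _ = _ := by rw [hK, hφ]; ring
    have hint : ∫⁻ r in Ioi (0 : ℝ), N r ^ Q *
        ENNReal.ofReal (Real.exp (-(α * Q / 2) * r ^ 2) * r) ≤ K * S * J := by
      refine (setLIntegral_mono' measurableSet_Ioi hpt).trans ?_
      have hind : ∀ k : ℕ, Measurable ((Ici √(k : ℝ)).indicator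
          (fun r => φ √(r ^ 2 + (8 - k)) * ENNReal.ofReal r)) := fun k =>
        ((hφm.comp (by fun_prop)).mul (by fun_prop)).indicator measurableSet_Ici
      rw [lintegral_tsum fun k => ((hind k).const_mul _).aemeasurable, hS, ← ENNReal.tsum_mul_left,
        ← ENNReal.tsum_mul_right]
      refine ENNReal.tsum_le_tsum fun k => ?_
      rw [lintegral_const_mul _ (hind k)]
      gcongr
      refine (setLIntegral_le_lintegral _ _).trans ?_
      rw [lintegral_indicator measurableSet_Ici]
      exact setLIntegral_comp_sqrt_le (Nat.cast_nonneg k) (by linarith) φ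
    rw [hJ']
    have hQ' : 0 ≤ 1 / Q := by positivity
    calc _ ≤ (ENNReal.ofReal (α * Q) * (K * S * J)) ^ (1 / Q) := by gcongr
      _ = _ := by rw [mul_left_comm, ENNReal.mul_rpow_of_nonneg _ _ hQ']

/-- Dilating the profile by a factor `κ < 1` makes its tail negligible. -/
lemma radialNorm_dilation_tail (hq : 0 < q) (hα : 0 < α) {κ : ℝ} (hκ : 0 < κ) (hκ1 : κ < 1) :
    ∃ K : ℝ≥0∞, K ≠ ∞ ∧ ∀ (N : ℝ → ℝ≥0∞) (R : ℝ), 0 ≤ R →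
      radialNorm q α (fun r => if R < r then N (κ * r) else 0) ≤
        K * ENNReal.ofReal (Real.exp (-(α * (1 - κ ^ 2) / 2) * R ^ 2)) * radialNorm q α N := by
  have hκ2 : 0 < 1 - κ ^ 2 := by nlinarith
  have hexp : ∀ {R r : ℝ}, 0 ≤ R → R < r → Real.exp (-(α / 2) * r ^ 2) ≤
      Real.exp (-(α * (1 - κ ^ 2) / 2) * R ^ 2) * Real.exp (-(α / 2) * (κ * r) ^ 2) := by
    intro R r hR hr
    rw [← Real.exp_add, Real.exp_le_exp]
    have h1 : R ^ 2 ≤ r ^ 2 := by gcongr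
    have := mul_le_mul_of_nonneg_left h1 (mul_pos hα hκ2).le
    nlinarith
  by_cases hqt : q = ∞
  · refine ⟨1, ENNReal.one_ne_top, fun N R hR => ?_⟩
    simp only [radialNorm, hqt, if_true, one_mul]
    refine iSup₂_le fun r hr => ?_
    split_ifs with h
    · calc N (κ * r) * ENNReal.ofReal (Real.exp (-(α / 2) * r ^ 2))
          ≤ N (κ * r) * ENNReal.ofReal (Real.exp (-(α * (1 - κ ^ 2) / 2) * R ^ 2) *
            Real.exp (-(α / 2) * (κ * r) ^ 2)) := by gcongr; exact hexp hR h
        _ = ENNReal.ofReal (Real.exp (-(α * (1 - κ ^ 2) / 2) * R ^ 2)) *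
            (N (κ * r) * ENNReal.ofReal (Real.exp (-(α / 2) * (κ * r) ^ 2))) := by
            rw [ENNReal.ofReal_mul (Real.exp_nonneg _)]; ring
        _ ≤ _ := by
            gcongr
            exact le_iSup₂ (f := fun (r : ℝ) (_ : 0 ≤ r) =>
              N r * ENNReal.ofReal (Real.exp (-(α / 2) * r ^ 2))) (κ * r) (by positivity)
    · simp
  · set Q := q.toReal with hQ
    have hQ0 : 0 < Q := ENNReal.toReal_pos hq.ne' hqt
    have hQ' : 0 ≤ 1 / Q := by positivity
    refine ⟨ENNReal.ofReal (κ ^ 2)⁻¹ ^ (1 / Q), ENNReal.rpow_ne_top_of_nonneg hQ' (by simp),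
      fun N R hR => ?_⟩
    simp only [radialNorm, hqt, if_false]
    set e := Real.exp (-(α * (1 - κ ^ 2) / 2) * R ^ 2) with he
    set ψ : ℝ → ℝ≥0∞ := fun s => N s ^ Q *
      ENNReal.ofReal (Real.exp (-(α * Q / 2) * s ^ 2) * s) with hψ
    have hcv : ∫⁻ s in Ioi (0 : ℝ), ψ s = ∫⁻ r in Ioi (0 : ℝ), ENNReal.ofReal κ * ψ (κ * r) := by
      have := lintegral_image_eq_lintegral_abs_deriv_mul (s := Ioi (0 : ℝ)) measurableSet_Ioi
        (f := fun r => κ * r) (f' := fun _ => κ)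
        (fun r _ => by simpa using ((hasDerivAt_id r).const_mul κ).hasDerivWithinAt)
        (fun x _ y _ h => mul_left_cancel₀ hκ.ne' h) ψ
      rwa [image_mul_left_Ioi hκ, mul_zero, abs_of_pos hκ] at this
    have hpt : ∀ r ∈ Ioi (0 : ℝ), (if R < r then N (κ * r) else 0) ^ Q *
        ENNReal.ofReal (Real.exp (-(α * Q / 2) * r ^ 2) * r) ≤
        ENNReal.ofReal (κ ^ 2)⁻¹ * ENNReal.ofReal e ^ Q * (ENNReal.ofReal κ * ψ (κ * r)) := by
      intro r hr
      have hr0 : 0 < r := hr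
      split_ifs with h
      · have h2 : Real.exp (-(α * Q / 2) * r ^ 2) ≤
            e ^ Q * Real.exp (-(α * Q / 2) * (κ * r) ^ 2) := by
          have := Real.rpow_le_rpow (Real.exp_nonneg _) (hexp hR h) hQ0.le
          rw [Real.mul_rpow (Real.exp_nonneg _) (Real.exp_nonneg _), ← Real.exp_mul _ Q,
            ← Real.exp_mul (-(α / 2) * (κ * r) ^ 2) Q] at this
          convert this using 2
          · ring
          · congr 1; ring
        calc _ ≤ N (κ * r) ^ Q * ENNReal.ofReal (e ^ Q *
              Real.exp (-(α * Q / 2) * (κ * r) ^ 2) * r) := by gcongr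
          _ = N (κ * r) ^ Q * ENNReal.ofReal ((κ ^ 2)⁻¹ * e ^ Q * (κ *
              (Real.exp (-(α * Q / 2) * (κ * r) ^ 2) * (κ * r)))) := by
              congr 2; field_simp
          _ = _ := by
              rw [ENNReal.ofReal_mul (by positivity), ENNReal.ofReal_mul (by positivity),
                ENNReal.ofReal_mul hκ.le, ENNReal.ofReal_rpow_of_nonneg (Real.exp_nonneg _) hQ0.le,
                hψ]
              ring
      · rw [ENNReal.zero_rpow_of_pos hQ0, zero_mul]; exact zero_le
    calc _ ≤ (ENNReal.ofReal (α * Q) * (ENNReal.ofReal (κ ^ 2)⁻¹ * ENNReal.ofReal e ^ Q *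
          ∫⁻ s in Ioi (0 : ℝ), ψ s)) ^ (1 / Q) := by
          gcongr
          rw [hcv, ← lintegral_const_mul' _ _ (ENNReal.mul_ne_top ENNReal.ofReal_ne_top
            (ENNReal.rpow_ne_top_of_nonneg hQ0.le ENNReal.ofReal_ne_top))]
          exact setLIntegral_mono' measurableSet_Ioi hpt
      _ = _ := by
          rw [mul_left_comm, ENNReal.mul_rpow_of_nonneg _ _ hQ', ENNReal.mul_rpow_of_nonneg _ _ hQ',
            ← ENNReal.rpow_mul, mul_one_div_cancel hQ0.ne', ENNReal.rpow_one]

/-! ### The radial maximal function -/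

/-- The radial maximal function `z ↦ sup_{0 ≤ x ≤ 1} |f(x z)|`. -/
def radialMax (f : ℂ → ℂ) (z : ℂ) : ℝ≥0∞ := ⨆ x ∈ Icc (0 : ℝ) 1, ‖f (x * z)‖ₑ

lemma le_radialMax (f : ℂ → ℂ) {x : ℝ} (hx : x ∈ Icc (0 : ℝ) 1) (z : ℂ) :
    ‖f (x * z)‖ₑ ≤ radialMax f z :=
  le_iSup₂ (f := fun (x : ℝ) (_ : x ∈ Icc (0 : ℝ) 1) => ‖f (x * z)‖ₑ) x hx

lemma measurable_radialMax {f : ℂ → ℂ} (hf : Continuous f) : Measurable (radialMax f) := by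
  refine LowerSemicontinuous.measurable ?_
  exact lowerSemicontinuous_biSup fun x _ => Continuous.lowerSemicontinuous (by fun_prop)

lemma radialMax_le {f : ℂ → ℂ} {z : ℂ} {c : ℝ≥0∞} {R : ℝ} (hz : ‖z‖ ≤ R)
    (h : ∀ w, ‖w‖ ≤ R → ‖f w‖ₑ ≤ c) : radialMax f z ≤ c := by
  refine iSup₂_le fun x hx => h _ ?_
  rw [norm_mul, Complex.norm_real, Real.norm_of_nonneg hx.1]
  exact (mul_le_of_le_one_left (norm_nonneg z) hx.2).trans hz

lemma radialMax_lt_top {f : ℂ → ℂ} (hf : Continuous f) (z : ℂ) : radialMax f z < ∞ := by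
  obtain ⟨C, hC⟩ := (isCompact_closedBall (0 : ℂ) ‖z‖).exists_bound_of_continuousOn hf.continuousOn
  refine (radialMax_le (c := ENNReal.ofReal C) le_rfl fun w hw => ?_).trans_lt
    ENNReal.ofReal_lt_top
  rw [← ofReal_norm]
  exact ENNReal.ofReal_le_ofReal (hC w (by simpa using hw))

lemma integralMean_mono {f : ℂ → ℂ} (hf : Differentiable ℂ f) (hp : 0 < p) :
    MonotoneOn (integralMean p f) (Ici 0) := by
  intro r hr R hR hrR
  have hr' : 0 ≤ r := hr
  unfold integralMean
  split_ifs with hpt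
  · refine iSup₂_le fun z hz => ?_
    rcases hrR.eq_or_lt with rfl | hlt
    · exact le_iSup₂ (f := fun (z : ℂ) (_ : ‖z‖ = r) => ‖f z‖ₑ) z hz
    obtain ⟨w, hw, hmax⟩ := (isCompact_sphere (0 : ℂ) R).exists_isMaxOn
      (NormedSpace.sphere_nonempty.2 hR) hf.continuous.norm.continuousOn
    refine le_trans ?_ (le_iSup₂ (f := fun (z : ℂ) (_ : ‖z‖ = R) => ‖f z‖ₑ) w (by simpa using hw))
    rw [← ofReal_norm, ← ofReal_norm]
    refine ENNReal.ofReal_le_ofReal ?_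
    refine Complex.norm_le_of_forall_mem_frontier_norm_le (U := Metric.ball 0 R)
      Metric.isBounded_ball hf.diffContOnCl (fun x hx => ?_) (subset_closure ?_)
    · rw [frontier_ball _ (hr'.trans_lt hlt).ne'] at hx
      exact hmax hx
    · simpa [hz] using hlt
  · refine ENNReal.rpow_le_rpow ?_ (by positivity)
    gcongr _ * ?_
    exact circleLIntegral_mono hf (ENNReal.toReal_pos hp.ne' hpt) hr' hrR

/-- Cutting the radial segment from `0` to `r u` into layers on which the square of the radius
varies by at most `1`. In the innermost layer the lower endpoint is `√` of a nonpositive number, that is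
`0`. -/
lemma radialMax_rpow_le_sum (f : ℂ → ℂ) {P : ℝ} (hP : 0 < P) {r : ℝ} (hr : 0 ≤ r) (u : ℂ) :
    radialMax f (r * u) ^ P ≤ ∑ k ∈ Finset.range (⌊r ^ 2⌋₊ + 1),
      ⨆ x ∈ Icc √(r ^ 2 - k - 1) √(r ^ 2 - k), ‖f (x * u)‖ₑ ^ P := by
  rw [← ENNReal.le_rpow_inv_iff hP]
  refine iSup₂_le fun x hx => ?_
  rw [ENNReal.le_rpow_inv_iff hP]
  -- the layer containing the radius `x * r`
  set k := ⌊r ^ 2 - (x * r) ^ 2⌋₊ with hk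
  have h0 : 0 ≤ r ^ 2 - (x * r) ^ 2 := by
    have : x * r ≤ r := mul_le_of_le_one_left hr hx.2
    have := mul_nonneg hx.1 hr
    nlinarith
  have h1 : (k : ℝ) ≤ r ^ 2 - (x * r) ^ 2 := Nat.floor_le h0
  have h2 : r ^ 2 - (x * r) ^ 2 < k + 1 := Nat.lt_floor_add_one _
  have hkm : k ∈ Finset.range (⌊r ^ 2⌋₊ + 1) := by
    rw [Finset.mem_range, Nat.lt_add_one_iff]
    exact Nat.floor_le_floor (by nlinarith [sq_nonneg (x * r)])
  refine le_trans ?_ (Finset.single_le_sum (fun _ _ => zero_le) hkm)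
  have hxr : x * r ∈ Icc √(r ^ 2 - k - 1) √(r ^ 2 - k) :=
    ⟨(Real.sqrt_le_left (mul_nonneg hx.1 hr)).2 (by linarith),
      Real.le_sqrt_of_sq_le (by linarith)⟩
  refine le_trans (le_of_eq ?_) (le_iSup₂ (f := fun (x : ℝ)
    (_ : x ∈ Icc √(r ^ 2 - k - 1) √(r ^ 2 - k)) => ‖f (x * u)‖ₑ ^ P) (x * r) hxr)
  push_cast
  rw [mul_assoc]

/-- The geometric condition of the local maximal inequality holds for the layer `[√(v - 1), √v]` and
the circle of radius `√(v + 8)`. -/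
lemma sqrt_layer_le {v : ℝ} (hv : 0 ≤ v) : 3 * √v - 2 * √(v - 1) ≤ √(v + 8) := by
  refine Real.le_sqrt_of_sq_le ?_
  have h1 := Real.sq_sqrt hv
  rcases le_total v 1 with h | h
  · rw [Real.sqrt_eq_zero_of_nonpos (by linarith : v - 1 ≤ 0)]
    nlinarith
  · have h2 := Real.sq_sqrt (by linarith : 0 ≤ v - 1)
    have h3 : √(v - 1) ≤ √v := Real.sqrt_le_sqrt (by linarith)
    nlinarith [Real.sqrt_nonneg (v - 1)]

/-- The circular mean of the radial maximal function over the circle of radius `r` is controlled by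
a circular mean of `f` over a circle of radius `√(r² + 8 - k)`, at the price of a factor growing
slowly in `k`. -/
lemma circleMean_radialMax_le (hp : 0 < p) {β : ℝ} (hβ : 0 < β) :
    ∃ A : ℝ≥0∞, A ≠ ∞ ∧ ∀ f : ℂ → ℂ, Differentiable ℂ f → ∀ r : ℝ, 0 ≤ r →
      ∃ k : ℕ, (k : ℝ) ≤ r ^ 2 ∧ circleMean p (radialMax f) r ≤
        A * ENNReal.ofReal (Real.exp (β * k)) * integralMean p f √(r ^ 2 + (8 - k)) := by
  by_cases hpt : p = ∞
  · refine ⟨1, ENNReal.one_ne_top, fun f hf r hr => ⟨0, by simpa using sq_nonneg r, ?_⟩⟩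
    have hrs : r ≤ √(r ^ 2 + 8) := Real.le_sqrt_of_sq_le (by linarith)
    simp only [Nat.cast_zero, mul_zero, Real.exp_zero, ENNReal.ofReal_one, one_mul, sub_zero]
    unfold circleMean
    rw [if_pos hpt]
    refine iSup₂_le fun z hz => radialMax_le hz.le fun w hw => ?_
    refine le_trans ?_ (integralMean_mono hf hp (norm_nonneg w)
      (mem_Ici.2 (Real.sqrt_nonneg _)) (hw.trans hrs))
    unfold integralMean
    rw [if_pos hpt]
    exact le_iSup₂ (f := fun (z : ℂ) (_ : ‖z‖ = ‖w‖) => ‖f z‖ₑ) w rfl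
  set P := p.toReal with hPdef
  have hP : 0 < P := ENNReal.toReal_pos hp.ne' hpt
  have hP' : 0 ≤ 1 / P := by positivity
  set S := ∑' k : ℕ, ENNReal.ofReal (Real.exp (-(β * P) * k)) with hS
  have hSt : S ≠ ∞ := (tsum_ofReal_exp_lt_top (by positivity)).ne
  refine ⟨(4 * S) ^ (1 / P), ENNReal.rpow_ne_top_of_nonneg hP' (ENNReal.mul_ne_top (by simp) hSt),
    fun f hf r hr => ?_⟩
  set c : ℕ → ℝ := fun k => √(r ^ 2 + (8 - k)) with hc
  set E : ℝ → ℝ≥0∞ := circleLIntegral (fun z => ‖f z‖ₑ ^ P) with hE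
  have hk : ∀ k ∈ Finset.range (⌊r ^ 2⌋₊ + 1), (k : ℝ) ≤ r ^ 2 := fun k hk =>
    (Nat.le_floor_iff (sq_nonneg r)).1 (Nat.lt_add_one_iff.1 (Finset.mem_range.1 hk))
  -- the layer whose exponentially weighted mean dominates all others
  obtain ⟨k₀, hk₀, hmax⟩ := Finset.exists_max_image (Finset.range (⌊r ^ 2⌋₊ + 1))
    (fun k => ENNReal.ofReal (Real.exp (β * P * k)) * E (c k)) ⟨0, by simp⟩
  refine ⟨k₀, hk k₀ hk₀, ?_⟩
  set X := ENNReal.ofReal (Real.exp (β * P * k₀)) * E (c k₀) with hX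
  have hlayer : ∀ k ∈ Finset.range (⌊r ^ 2⌋₊ + 1),
      ∫⁻ θ in Ioc (0 : ℝ) (2 * Real.pi), ⨆ x ∈ Icc √(r ^ 2 - k - 1) √(r ^ 2 - k),
        ‖f ((x : ℂ) * Complex.exp ((θ : ℂ) * Complex.I))‖ₑ ^ P ≤ 4 * E (c k) := fun k hk' => by
    have hv : 0 ≤ r ^ 2 - k := sub_nonneg.2 (hk k hk')
    have he : r ^ 2 + (8 - (k : ℝ)) = (r ^ 2 - k) + 8 := by ring
    refine lintegral_iSup_Icc_le hf hP (Real.sqrt_nonneg _) ?_ ?_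
    · exact Real.sqrt_lt_sqrt hv (by linarith)
    · simp only [hc, he]
      exact sqrt_layer_le hv
  have hEX : ∀ k ∈ Finset.range (⌊r ^ 2⌋₊ + 1),
      E (c k) ≤ ENNReal.ofReal (Real.exp (-(β * P) * k)) * X := fun k hk' => by
    calc E (c k) = ENNReal.ofReal (Real.exp (-(β * P) * k)) *
          (ENNReal.ofReal (Real.exp (β * P * k)) * E (c k)) := by
          rw [← mul_assoc, ← ENNReal.ofReal_mul (Real.exp_nonneg _), ← Real.exp_add]
          simp
      _ ≤ _ := by gcongr; exact hmax k hk'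
  have hmain : circleLIntegral (fun z => radialMax f z ^ P) r ≤ 4 * S * X := by
    calc circleLIntegral (fun z => radialMax f z ^ P) r
        ≤ ∫⁻ θ in Ioc (0 : ℝ) (2 * Real.pi), ∑ k ∈ Finset.range (⌊r ^ 2⌋₊ + 1),
          ⨆ x ∈ Icc √(r ^ 2 - k - 1) √(r ^ 2 - k),
          ‖f ((x : ℂ) * Complex.exp ((θ : ℂ) * Complex.I))‖ₑ ^ P :=
          lintegral_mono fun θ => radialMax_rpow_le_sum f hP hr _
      _ = ∑ k ∈ Finset.range (⌊r ^ 2⌋₊ + 1), ∫⁻ θ in Ioc (0 : ℝ) (2 * Real.pi),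
          ⨆ x ∈ Icc √(r ^ 2 - k - 1) √(r ^ 2 - k),
          ‖f ((x : ℂ) * Complex.exp ((θ : ℂ) * Complex.I))‖ₑ ^ P := by
          refine lintegral_finsetSum _ fun k _ => LowerSemicontinuous.measurable ?_
          refine lowerSemicontinuous_biSup fun x _ => Continuous.lowerSemicontinuous ?_
          exact ENNReal.continuous_rpow_const.comp (by have := hf.continuous; fun_prop)
      _ ≤ ∑ k ∈ Finset.range (⌊r ^ 2⌋₊ + 1),
          4 * (ENNReal.ofReal (Real.exp (-(β * P) * k)) * X) :=
          Finset.sum_le_sum fun k hk' => (hlayer k hk').trans (by gcongr; exact hEX k hk')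
      _ = 4 * (∑ k ∈ Finset.range (⌊r ^ 2⌋₊ + 1),
          ENNReal.ofReal (Real.exp (-(β * P) * k))) * X := by
          rw [← Finset.mul_sum, ← Finset.sum_mul, mul_assoc]
      _ ≤ _ := by gcongr; exact ENNReal.sum_le_tsum _
  unfold circleMean integralMean
  rw [if_neg hpt, if_neg hpt]
  calc _ ≤ (ENNReal.ofReal (1 / (2 * Real.pi)) * (4 * S * X)) ^ (1 / P) := by gcongr
    _ = (4 * S) ^ (1 / P) * ENNReal.ofReal (Real.exp (β * k₀)) *
        (ENNReal.ofReal (1 / (2 * Real.pi)) * E (c k₀)) ^ (1 / P) := by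
        have : ENNReal.ofReal (Real.exp (β * k₀)) =
            ENNReal.ofReal (Real.exp (β * P * k₀)) ^ (1 / P) := by
          rw [ENNReal.ofReal_rpow_of_nonneg (Real.exp_nonneg _) hP', ← Real.exp_mul]
          congr 2; field_simp
        rw [this, ← ENNReal.mul_rpow_of_nonneg _ _ hP', ← ENNReal.mul_rpow_of_nonneg _ _ hP', hX]
        congr 1; ring
    _ = _ := rfl

/-- The radial maximal operator is bounded on the mixed norm Fock spaces, for all exponents. -/
theorem mixedNorm_radialMax_le (hp : 0 < p) (hq : 0 < q) (hα : 0 < α) :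
    ∃ C : ℝ≥0∞, C ≠ ∞ ∧ ∀ f : ℂ → ℂ, Differentiable ℂ f →
      mixedNorm p q α (radialMax f) ≤ C * fockNorm p q α f := by
  obtain ⟨A, hA, h⟩ := circleMean_radialMax_le (p := p) hp (β := α / 4) (by positivity)
  obtain ⟨C, hC, hC'⟩ := radialNorm_le_of_shift hq hα hA
  exact ⟨C, hC, fun f hf => hC' _ _ (measurable_integralMean p hf.continuous) (h f hf)⟩

lemma monotoneOn_circleMean_radialMax (f : ℂ → ℂ) :
    MonotoneOn (circleMean p (radialMax f)) (Ici 0) := by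
  intro r hr R hR hrR
  refine circleMean_mono_of_sphere (fun u hu => ?_) hR
  refine iSup₂_le fun x hx => ?_
  rcases (mem_Ici.1 hR).eq_or_lt with rfl | hR0
  · obtain rfl : r = 0 := le_antisymm hrR hr
    exact le_radialMax f hx _
  refine le_trans (le_of_eq ?_) (le_radialMax f (x := x * r / R)
    ⟨div_nonneg (mul_nonneg hx.1 hr) hR, ?_⟩ _)
  · congr 2
    push_cast
    field_simp [Complex.ofReal_ne_zero.2 hR0.ne']
  · rw [div_le_one hR0]
    exact (mul_le_of_le_one_left hr hx.2).trans hrR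

lemma enorm_le_integralMean (hp : 0 < p) {R : ℝ} (hR : 0 ≤ R) :
    ∃ C : ℝ≥0∞, C ≠ ∞ ∧ ∀ f : ℂ → ℂ, Differentiable ℂ f → ∀ z, ‖z‖ ≤ R →
      ‖f z‖ₑ ≤ C * integralMean p f (R + 1) := by
  by_cases hpt : p = ∞
  · refine ⟨1, ENNReal.one_ne_top, fun f hf z hz => ?_⟩
    rw [one_mul]
    refine le_trans ?_ (integralMean_mono hf hp (norm_nonneg z) (mem_Ici.2 (by linarith))
      (by linarith : ‖z‖ ≤ R + 1))
    unfold integralMean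
    rw [if_pos hpt]
    exact le_iSup₂ (f := fun (w : ℂ) (_ : ‖w‖ = ‖z‖) => ‖f w‖ₑ) z rfl
  set P := p.toReal with hPdef
  have hP : 0 < P := ENNReal.toReal_pos hp.ne' hpt
  have hP' : 0 ≤ 1 / P := by positivity
  have hpi : (0 : ℝ) < 2 * Real.pi := by positivity
  set V := volume (Metric.ball (0 : ℂ) 1) with hV
  have hV0 : V ≠ 0 := (Metric.measure_ball_pos _ _ one_pos).ne'
  have hVt : V ≠ ∞ := measure_ball_lt_top.ne
  set W := volume (Metric.ball (0 : ℂ) (R + 1)) with hW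
  have hWt : W ≠ ∞ := measure_ball_lt_top.ne
  refine ⟨(W / V) ^ (1 / P), ENNReal.rpow_ne_top_of_nonneg hP' (ENNReal.div_ne_top hWt hV0),
    fun f hf z hz => ?_⟩
  have hfc := hf.continuous
  set M := circleLIntegral (fun z => ‖f z‖ₑ ^ P) (R + 1) with hM
  -- averaging over rotations bounds the integral over a disc by a circular mean
  have h1 : ∫⁻ w in Metric.ball (0 : ℂ) (R + 1), ‖f w‖ₑ ^ P ≤
      ENNReal.ofReal (1 / (2 * Real.pi)) * (W * M) := by
    have hm : Measurable (Function.uncurry fun (θ : ℝ) (w : ℂ) =>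
        ‖f (w * Complex.exp ((θ : ℂ) * Complex.I))‖ₑ ^ P) :=
      (Continuous.measurable (by fun_prop)).pow_const P
    have h2 : ENNReal.ofReal (2 * Real.pi) * ∫⁻ w in Metric.ball (0 : ℂ) (R + 1), ‖f w‖ₑ ^ P ≤
        W * M := by
      calc _ = ∫⁻ θ in Ioc (0 : ℝ) (2 * Real.pi), ∫⁻ w in Metric.ball (0 : ℂ) (R + 1),
            ‖f (w * Complex.exp ((θ : ℂ) * Complex.I))‖ₑ ^ P := by
            simp_rw [setLIntegral_ball_comp_mul_exp (fun w => ‖f w‖ₑ ^ P)]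
            simp [mul_comm]
        _ = ∫⁻ w in Metric.ball (0 : ℂ) (R + 1), ∫⁻ θ in Ioc (0 : ℝ) (2 * Real.pi),
            ‖f (w * Complex.exp ((θ : ℂ) * Complex.I))‖ₑ ^ P :=
            lintegral_lintegral_swap hm.aemeasurable
        _ ≤ ∫⁻ w in Metric.ball (0 : ℂ) (R + 1), M := by
            refine setLIntegral_mono measurable_const fun w hw => ?_
            rw [lintegral_comp_mul_exp hfc hP]
            exact circleLIntegral_mono hf hP (norm_nonneg _) (mem_ball_zero_iff.1 hw).le
        _ = W * M := by rw [setLIntegral_const, mul_comm]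
    calc _ = ENNReal.ofReal (1 / (2 * Real.pi)) * (ENNReal.ofReal (2 * Real.pi) *
          ∫⁻ w in Metric.ball (0 : ℂ) (R + 1), ‖f w‖ₑ ^ P) := by
          rw [← mul_assoc, ← ENNReal.ofReal_mul (by positivity), one_div_mul_cancel hpi.ne',
            ENNReal.ofReal_one, one_mul]
      _ ≤ _ := by gcongr
  have h3 : ‖f z‖ₑ ^ P * V ≤ W * (ENNReal.ofReal (1 / (2 * Real.pi)) * M) := by
    refine (enorm_rpow_mul_volume_le hf hP z 1).trans (le_trans ?_ (h1.trans_eq (by ring)))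
    calc ∫⁻ w in Metric.ball (0 : ℂ) 1, ‖f (z + w)‖ₑ ^ P
        = ∫⁻ w in (fun w : ℂ => w + z) ⁻¹' Metric.ball z 1, ‖f (w + z)‖ₑ ^ P := by
          congr 2
          · ext w; simp
          · ext w; rw [add_comm]
      _ = ∫⁻ w in Metric.ball z 1, ‖f w‖ₑ ^ P :=
          (measurePreserving_add_right volume z).setLIntegral_comp_preimage_emb
            (measurableEmbedding_addRight _) (fun w => ‖f w‖ₑ ^ P) _
      _ ≤ _ := lintegral_mono_set (Metric.ball_subset_ball' (by
          rw [dist_zero_right]; linarith))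
  have h4 : ‖f z‖ₑ ^ P ≤ W / V * (ENNReal.ofReal (1 / (2 * Real.pi)) * M) := by
    rw [ENNReal.mul_comm_div, ← mul_div_assoc]
    exact (ENNReal.le_div_iff_mul_le (Or.inl hV0) (Or.inl hVt)).2 h3
  unfold integralMean
  rw [if_neg hpt]
  calc ‖f z‖ₑ ≤ (W / V * (ENNReal.ofReal (1 / (2 * Real.pi)) * M)) ^ (1 / P) := by
        rw [one_div P]; exact (ENNReal.le_rpow_inv_iff hP).2 h4
    _ = _ := ENNReal.mul_rpow_of_nonneg _ _ hP'

/-- Point evaluations are bounded on the mixed norm Fock spaces, uniformly on discs. -/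
theorem enorm_le_fockNorm (hp : 0 < p) (hq : 0 < q) (hα : 0 < α) {R : ℝ} (hR : 0 ≤ R) :
    ∃ C : ℝ≥0∞, C ≠ ∞ ∧ ∀ f : ℂ → ℂ, Differentiable ℂ f → ∀ z, ‖z‖ ≤ R →
      ‖f z‖ₑ ≤ C * fockNorm p q α f := by
  obtain ⟨C, hC, h⟩ := enorm_le_integralMean (p := p) hp hR
  obtain ⟨D, hD, h'⟩ := le_mul_radialNorm (q := q) hq hα (ρ := R + 1) (by linarith)
  refine ⟨C * D, ENNReal.mul_ne_top hC hD, fun f hf z hz => (h f hf z hz).trans ?_⟩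
  rw [mul_assoc]
  gcongr
  exact h' _ (integralMean_mono hf hp)

/-! ### Montel's theorem, Fatou's lemma and the topology -/

open Filter

/-- **Montel's theorem** for entire functions. -/
theorem exists_subseq_tendsto_of_entire {f : ℕ → ℂ → ℂ} (hf : ∀ n, Differentiable ℂ (f n))
    (hb : ∀ R : ℝ, 0 < R → ∃ B : ℝ, ∀ n z, ‖z‖ ≤ R → ‖f n z‖ ≤ B) :
    ∃ (φ : ℕ → ℕ) (g : ℂ → ℂ), StrictMono φ ∧ Differentiable ℂ g ∧
      ∀ R ε : ℝ, 0 < ε → ∀ᶠ n in atTop, ∀ z, ‖z‖ ≤ R → ‖f (φ n) z - g z‖ ≤ ε := by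
  choose! B hB using hb
  set a : ℕ → ℕ → ℂ := fun n k => (k.factorial : ℂ)⁻¹ * iteratedDeriv k (f n) 0 with ha
  have hsum : ∀ n z, HasSum (fun k => a n k * z ^ k) (f n z) := fun n z => by
    have he : (fun k => a n k * z ^ k) =
        fun k => (k.factorial : ℂ)⁻¹ • (z - 0) ^ k • iteratedDeriv k (f n) 0 := by
      funext k
      simp only [ha, sub_zero, smul_eq_mul]
      ring
    rw [he]
    exact Complex.hasSum_taylorSeries_of_entire (hf n) 0 z
  have hcauchy : ∀ R : ℝ, 0 < R → ∀ n k, ‖a n k‖ ≤ B R / R ^ k := fun R hR n k => by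
    have := Complex.norm_iteratedDeriv_le_of_forall_mem_sphere_norm_le k hR
      ((hf n).diffContOnCl (s := Metric.ball 0 R)) (C := B R) fun z hz =>
        hB R hR n z (by simpa using (mem_sphere_zero_iff_norm.1 hz).le)
    have hk : (0 : ℝ) < k.factorial := by positivity
    rw [ha, norm_mul, norm_inv, Complex.norm_natCast, inv_mul_le_iff₀ hk]
    exact this.trans_eq (mul_div_assoc _ _ _)
  -- Tychonoff: a subsequence along which every Taylor coefficient converges
  obtain ⟨b, -, φ, hφ, hlim⟩ := (isCompact_univ_pi (fun k : ℕ =>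
    isCompact_closedBall (0 : ℂ) (B 1))).tendsto_subseq (x := a) fun n => by
      simpa [mem_univ_pi] using fun k => by simpa using hcauchy 1 one_pos n k
  have hlim' : ∀ k, Tendsto (fun n => a (φ n) k) atTop (𝓝 (b k)) := fun k =>
    (tendsto_pi_nhds.1 hlim) k
  have hbb : ∀ R : ℝ, 0 < R → ∀ k, ‖b k‖ ≤ B R / R ^ k := fun R hR k =>
    le_of_tendsto' (hlim' k).norm fun n => hcauchy R hR (φ n) k
  have hpow : ∀ {R : ℝ}, 0 < R → ∀ {c : ℂ} {k : ℕ}, ‖c‖ ≤ B (2 * R) / (2 * R) ^ k →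
      ‖c‖ * R ^ k ≤ B (2 * R) * (1 / 2) ^ k := fun {R} hR {c k} hc => by
    calc ‖c‖ * R ^ k ≤ B (2 * R) / (2 * R) ^ k * R ^ k := by gcongr
      _ = _ := by rw [mul_pow, one_div, inv_pow]; field_simp
  have hgeo : ∀ R : ℝ, Summable fun k : ℕ => B (2 * R) * (1 / 2 : ℝ) ^ k := fun R =>
    summable_geometric_two.mul_left _
  set g : ℂ → ℂ := fun z => ∑' k, b k * z ^ k with hg
  have hsumg : ∀ R : ℝ, 0 < R → ∀ z : ℂ, ‖z‖ ≤ R → Summable fun k => b k * z ^ k :=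
    fun R hR z hz => by
      refine Summable.of_norm_bounded (hgeo R) fun k => ?_
      rw [norm_mul, norm_pow]
      exact (mul_le_mul_of_nonneg_left (pow_le_pow_left₀ (norm_nonneg z) hz k)
        (norm_nonneg _)).trans (hpow hR (hbb _ (by positivity) k))
  have hconv : ∀ R : ℝ, 0 < R → ∀ ε : ℝ, 0 < ε →
      ∀ᶠ n in atTop, ∀ z, ‖z‖ ≤ R → ‖f (φ n) z - g z‖ ≤ ε := fun R hR ε hε => by
    have hdom : ∀ n k, ‖a (φ n) k - b k‖ * R ^ k ≤ 2 * (B (2 * R) * (1 / 2) ^ k) := fun n k => by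
      calc ‖a (φ n) k - b k‖ * R ^ k ≤ (‖a (φ n) k‖ + ‖b k‖) * R ^ k := by
            gcongr; exact norm_sub_le _ _
        _ ≤ _ := by
            rw [add_mul, two_mul]
            exact add_le_add (hpow hR (hcauchy _ (by positivity) _ k))
              (hpow hR (hbb _ (by positivity) k))
    have ht : Tendsto (fun n => ∑' k, ‖a (φ n) k - b k‖ * R ^ k) atTop (𝓝 (∑' _ : ℕ, (0 : ℝ))) := by
      refine tendsto_tsum_of_dominated_convergence ((hgeo R).mul_left 2) (fun k => ?_)
        (Eventually.of_forall fun n k => ?_)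
      · simpa using ((hlim' k).sub_const (b k)).norm.mul_const (R ^ k)
      · rw [Real.norm_of_nonneg (by positivity)]
        exact hdom n k
    rw [tsum_zero] at ht
    filter_upwards [ht.eventually (gt_mem_nhds hε)] with n hn z hz
    have hs : HasSum (fun k => (a (φ n) k - b k) * z ^ k) (f (φ n) z - g z) := by
      simpa only [sub_mul] using (hsum (φ n) z).sub (hsumg R hR z hz).hasSum
    rw [← hs.tsum_eq]
    refine (tsum_of_norm_bounded (Summable.of_nonneg_of_le (fun k => by positivity) (hdom n)
      ((hgeo R).mul_left 2)).hasSum fun k => ?_).trans hn.le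
    rw [norm_mul, norm_pow]
    gcongr
  refine ⟨φ, g, hφ, ?_, fun R ε hε => ?_⟩
  · have hloc : TendstoLocallyUniformlyOn (fun n => f (φ n)) g atTop univ := by
      rw [Metric.tendstoLocallyUniformlyOn_iff]
      intro ε hε x _
      refine ⟨Metric.ball 0 (‖x‖ + 1), mem_nhdsWithin_of_mem_nhds
        (Metric.isOpen_ball.mem_nhds (by simp)), ?_⟩
      filter_upwards [hconv (‖x‖ + 1) (by positivity) (ε / 2) (by positivity)] with n hn z hz
      rw [dist_comm, dist_eq_norm]
      exact (hn z (mem_ball_zero_iff.1 hz).le).trans_lt (half_lt_self hε)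
    exact differentiableOn_univ.1 (hloc.differentiableOn
      (Eventually.of_forall fun n => (hf (φ n)).differentiableOn) isOpen_univ)
  · filter_upwards [hconv (max R 1) (by positivity) ε hε] with n hn z hz
    exact hn z (hz.trans (le_max_left _ _))

lemma rpow_liminf {s : ℝ} (hs : 0 ≤ s) (u : ℕ → ℝ≥0∞) :
    (liminf u atTop) ^ s = liminf (fun n => u n ^ s) atTop :=
  (ENNReal.monotone_rpow_of_nonneg hs).map_liminf_of_continuousAt u
    ENNReal.continuous_rpow_const.continuousAt

lemma const_mul_liminf {c : ℝ≥0∞} (hc : c ≠ ∞) (u : ℕ → ℝ≥0∞) :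
    c * liminf u atTop = liminf (fun n => c * u n) atTop :=
  Monotone.map_liminf_of_continuousAt (f := fun x => c * x) (fun _ _ h => mul_le_mul_right h c) u
    (ENNReal.continuous_const_mul hc).continuousAt

lemma integralMean_le_liminf (hp : 0 < p) {f : ℕ → ℂ → ℂ} {g : ℂ → ℂ} (hf : ∀ n, Continuous (f n))
    (h : ∀ z, Tendsto (fun n => f n z) atTop (𝓝 (g z))) (r : ℝ) :
    integralMean p g r ≤ liminf (fun n => integralMean p (f n) r) atTop := by
  have h' : ∀ z, ‖g z‖ₑ = liminf (fun n => ‖f n z‖ₑ) atTop := fun z => (h z).enorm.liminf_eq.symm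
  unfold integralMean
  split_ifs with hpt
  · refine iSup₂_le fun z hz => ?_
    rw [h']
    exact liminf_le_liminf (Eventually.of_forall fun n =>
      le_iSup₂ (f := fun (z : ℂ) (_ : ‖z‖ = r) => ‖f n z‖ₑ) z hz)
  · have hP : 0 < p.toReal := ENNReal.toReal_pos hp.ne' hpt
    rw [← rpow_liminf (by positivity), ← const_mul_liminf ENNReal.ofReal_ne_top]
    gcongr
    simp_rw [h', rpow_liminf hP.le]
    refine lintegral_liminf_le fun n => ?_
    exact (Continuous.measurable (by have := hf n; fun_prop)).pow_const _

/-- Closed balls of the mixed norm Fock space are closed under pointwise limits. -/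
lemma fockNorm_le_of_tendsto (hp : 0 < p) (hq : 0 < q) {f : ℕ → ℂ → ℂ} {g : ℂ → ℂ}
    (hf : ∀ n, Continuous (f n)) (h : ∀ z, Tendsto (fun n => f n z) atTop (𝓝 (g z)))
    {c : ℝ≥0∞} (hc : ∀ n, fockNorm p q α (f n) ≤ c) : fockNorm p q α g ≤ c := by
  have hN := integralMean_le_liminf hp hf h
  have hlim : ∀ {u : ℕ → ℝ≥0∞}, (∀ n, u n ≤ c) → liminf u atTop ≤ c := fun {u} hu =>
    (liminf_le_liminf (Eventually.of_forall hu)).trans_eq (liminf_const c)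
  unfold fockNorm at hc ⊢
  split_ifs at hc ⊢ with hqt
  · refine iSup₂_le fun r hr => ?_
    refine (mul_le_mul_left (hN r) _).trans ?_
    rw [mul_comm, const_mul_liminf ENNReal.ofReal_ne_top]
    refine hlim fun n => ?_
    rw [mul_comm]
    exact (le_iSup₂ (f := fun (r : ℝ) (_ : 0 ≤ r) => integralMean p (f n) r *
      ENNReal.ofReal (Real.exp (-(α / 2) * r ^ 2))) r hr).trans (hc n)
  · have hQ : 0 < q.toReal := ENNReal.toReal_pos hq.ne' hqt
    refine le_trans ?_ (hlim hc)
    rw [← rpow_liminf (by positivity), ← const_mul_liminf ENNReal.ofReal_ne_top]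
    gcongr
    refine le_trans (lintegral_mono fun r => ?_) (lintegral_liminf_le fun n =>
      ((measurable_integralMean p (hf n)).pow_const _).mul (by fun_prop))
    refine (mul_le_mul_left (ENNReal.rpow_le_rpow (hN r) hQ.le) _).trans ?_
    rw [rpow_liminf hQ.le, mul_comm, const_mul_liminf ENNReal.ofReal_ne_top]
    simp_rw [mul_comm]
    exact le_rfl

section Topology

variable {G : Type*} [AddCommGroup G] {B : AddGroupFilterBasis G} {N : G → ℝ≥0∞}

lemma nhds_zero_eq_comap (hB : ∀ U, U ∈ B ↔ ∃ ε : ℝ≥0∞, 0 < ε ∧ U = {x | N x < ε}) :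
    @nhds G B.topology 0 = comap N (𝓝 0) := by
  have h1 := B.nhds_zero_hasBasis
  have h2 := ENNReal.nhds_zero_basis.comap N
  ext U
  rw [h1.mem_iff, h2.mem_iff]
  constructor
  · rintro ⟨V, hV, hVU⟩
    obtain ⟨ε, hε, rfl⟩ := (hB V).1 hV
    exact ⟨ε, hε, hVU⟩
  · rintro ⟨ε, hε, hU⟩
    exact ⟨_, (hB _).2 ⟨ε, hε, rfl⟩, hU⟩

/-- Sequential criterion for compactness in a group topologised by a (quasi-)norm. -/
lemma isCompact_of_exists_subseq (hB : ∀ U, U ∈ B ↔ ∃ ε : ℝ≥0∞, 0 < ε ∧ U = {x | N x < ε})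
    {K : Set G} (h : ∀ u : ℕ → G, (∀ n, u n ∈ K) → ∃ x ∈ K, ∃ φ : ℕ → ℕ, StrictMono φ ∧
      Tendsto (fun n => N (u (φ n) - x)) atTop (𝓝 0)) : @IsCompact G B.topology K := by
  let : TopologicalSpace G := B.topology
  have : IsTopologicalAddGroup G := B.isTopologicalAddGroup
  let : UniformSpace G := IsTopologicalAddGroup.rightUniformSpace G
  have : IsUniformAddGroup G := isUniformAddGroup_of_addCommGroup
  have h0 : 𝓝 (0 : G) = comap N (𝓝 0) := nhds_zero_eq_comap hB
  have : (𝓝 (0 : G)).IsCountablyGenerated := by rw [h0]; infer_instance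
  have : (uniformity G).IsCountablyGenerated := IsUniformAddGroup.uniformity_countably_generated
  refine IsSeqCompact.isCompact fun u hu => ?_
  obtain ⟨x, hx, φ, hφ, hlim⟩ := h u hu
  refine ⟨x, hx, φ, hφ, ?_⟩
  rw [← tendsto_sub_nhds_zero_iff, h0, tendsto_comap_iff]
  exact hlim

/-- A sequence in a compact set of a group topologised by a (quasi-)norm has a cluster point. -/
lemma exists_frequently_lt_of_isCompact
    (hB : ∀ U, U ∈ B ↔ ∃ ε : ℝ≥0∞, 0 < ε ∧ U = {x | N x < ε})
    {K : Set G} (hK : @IsCompact G B.topology K) {u : ℕ → G} (hu : ∀ n, u n ∈ K) :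
    ∃ x, ∀ ε : ℝ≥0∞, 0 < ε → ∃ᶠ n in atTop, N (u n - x) < ε := by
  let : TopologicalSpace G := B.topology
  have : IsTopologicalAddGroup G := B.isTopologicalAddGroup
  obtain ⟨x, -, hx⟩ := IsCompact.exists_mapClusterPt hK (f := atTop) (u := u)
    (le_principal_iff.2 (mem_map.2 (Eventually.of_forall hu)))
  refine ⟨x, fun ε hε => ?_⟩
  have h0 : 𝓝 (0 : G) = comap N (𝓝 0) := nhds_zero_eq_comap hB
  have hV : {y : G | N y < ε} ∈ 𝓝 (0 : G) := by
    rw [h0]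
    exact preimage_mem_comap (Iio_mem_nhds hε)
  have hc : Tendsto (fun y : G => y - x) (𝓝 x) (𝓝 0) := by
    have hcont : Continuous fun y : G => y - x := continuous_id.sub continuous_const
    simpa only [sub_self] using hcont.tendsto x
  exact hx.frequently (hc hV)

end Topology

/-! ### The Hausdorff operator -/

variable {μ : Measure (Ioi (0 : ℝ))}

lemma continuous_hausdorffIntegrand {f : ℂ → ℂ} (hf : Continuous f) (z : ℂ) :
    Continuous (hausdorffIntegrand f z) := by
  have hi : Continuous fun t : Ioi (0 : ℝ) => ((t : ℝ) : ℂ) := by fun_prop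
  have h0 : ∀ t : Ioi (0 : ℝ), ((t : ℝ) : ℂ) ≠ 0 := fun t => Complex.ofReal_ne_zero.2 (ne_of_gt t.2)
  exact (hf.comp (continuous_const.div hi h0)).div hi h0

lemma enorm_hausdorffIntegrand (f : ℂ → ℂ) (z : ℂ) (t : Ioi (0 : ℝ)) :
    ‖hausdorffIntegrand f z t‖ₑ = ENNReal.ofReal (1 / (t : ℝ)) * ‖f (z / ((t : ℝ) : ℂ))‖ₑ := by
  have ht : (0 : ℝ) < t := t.2
  rw [hausdorffIntegrand, div_eq_mul_inv, enorm_mul, mul_comm, one_div, ← ofReal_norm, norm_inv,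
    Complex.norm_real, Real.norm_of_nonneg ht.le]

lemma measurable_weight : Measurable fun t : Ioi (0 : ℝ) => ENNReal.ofReal (1 / (t : ℝ)) := by
  fun_prop

lemma enorm_comp_div_le_radialMax (f : ℂ → ℂ) (z : ℂ) {τ t : ℝ} (hτ : 0 < τ) (ht : τ ≤ t) :
    ‖f (z / (t : ℂ))‖ₑ ≤ radialMax f ((τ⁻¹ : ℝ) * z) := by
  have ht0 : 0 < t := hτ.trans_le ht
  refine le_trans (le_of_eq ?_) (le_radialMax f (x := τ / t)
    ⟨by positivity, (div_le_one ht0).2 ht⟩ _)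
  have h1 : (τ : ℂ) ≠ 0 := Complex.ofReal_ne_zero.2 hτ.ne'
  have h2 : (t : ℂ) ≠ 0 := Complex.ofReal_ne_zero.2 ht0.ne'
  congr 2
  push_cast
  field_simp

/-- The mass which `dμ(t) / t` puts to the left of `τ`. -/
def headMass (μ : Measure (Ioi (0 : ℝ))) (τ : ℝ) : ℝ≥0∞ :=
  ∫⁻ t in {t : Ioi (0 : ℝ) | (t : ℝ) < τ}, ENNReal.ofReal (1 / (t : ℝ)) ∂μ

lemma ae_one_lt (h0 : μ {t : Ioi (0 : ℝ) | (t : ℝ) ≤ 1} = 0) :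
    ∀ᵐ t : Ioi (0 : ℝ) ∂μ, 1 < (t : ℝ) := by
  rw [ae_iff]
  simpa only [not_lt] using h0

lemma lintegral_hausdorffIntegrand_le
    (hμ : ∫⁻ t : Ioi (0 : ℝ), ENNReal.ofReal (1 / (t : ℝ)) ∂μ = 1)
    (h0 : μ {t : Ioi (0 : ℝ) | (t : ℝ) ≤ 1} = 0) (f : ℂ → ℂ) (z : ℂ) {τ : ℝ} (hτ : 1 ≤ τ) :
    ∫⁻ t, ‖hausdorffIntegrand f z t‖ₑ ∂μ ≤
      headMass μ τ * radialMax f z + radialMax f ((τ⁻¹ : ℝ) * z) := by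
  have hs : MeasurableSet {t : Ioi (0 : ℝ) | (t : ℝ) < τ} :=
    measurableSet_lt measurable_subtype_coe measurable_const
  rw [← lintegral_add_compl _ hs]
  refine add_le_add ?_ ?_
  · rw [headMass, ← lintegral_mul_const _ measurable_weight]
    refine lintegral_mono_ae ((ae_restrict_of_ae (ae_one_lt h0)).mono fun t ht => ?_)
    rw [enorm_hausdorffIntegrand]
    gcongr
    simpa using enorm_comp_div_le_radialMax f z one_pos ht.le
  · calc _ ≤ ∫⁻ t in {t : Ioi (0 : ℝ) | (t : ℝ) < τ}ᶜ, ENNReal.ofReal (1 / (t : ℝ)) *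
          radialMax f ((τ⁻¹ : ℝ) * z) ∂μ := by
          refine setLIntegral_mono' hs.compl fun t ht => ?_
          rw [enorm_hausdorffIntegrand]
          gcongr
          exact enorm_comp_div_le_radialMax f z (by linarith) (not_lt.1 ht)
      _ ≤ ∫⁻ t, ENNReal.ofReal (1 / (t : ℝ)) * radialMax f ((τ⁻¹ : ℝ) * z) ∂μ :=
          setLIntegral_le_lintegral _ _
      _ = _ := by rw [lintegral_mul_const _ measurable_weight, hμ, one_mul]

lemma headMass_one (h0 : μ {t : Ioi (0 : ℝ) | (t : ℝ) ≤ 1} = 0) : headMass μ 1 = 0 := by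
  refine setLIntegral_measure_zero _ _ (measure_mono_null (fun t ht => ?_) h0)
  exact le_of_lt (mem_ofPred.1 ht)

lemma lintegral_hausdorffIntegrand_le_radialMax
    (hμ : ∫⁻ t : Ioi (0 : ℝ), ENNReal.ofReal (1 / (t : ℝ)) ∂μ = 1)
    (h0 : μ {t : Ioi (0 : ℝ) | (t : ℝ) ≤ 1} = 0) (f : ℂ → ℂ) (z : ℂ) :
    ∫⁻ t, ‖hausdorffIntegrand f z t‖ₑ ∂μ ≤ radialMax f z := by
  simpa [headMass_one h0] using lintegral_hausdorffIntegrand_le hμ h0 f z le_rfl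

lemma integrable_hausdorffIntegrand
    (hμ : ∫⁻ t : Ioi (0 : ℝ), ENNReal.ofReal (1 / (t : ℝ)) ∂μ = 1)
    (h0 : μ {t : Ioi (0 : ℝ) | (t : ℝ) ≤ 1} = 0) {f : ℂ → ℂ} (hf : Continuous f) (z : ℂ) :
    Integrable (hausdorffIntegrand f z) μ :=
  ⟨(continuous_hausdorffIntegrand hf z).aestronglyMeasurable,
    (lintegral_hausdorffIntegrand_le_radialMax hμ h0 f z).trans_lt (radialMax_lt_top hf z)⟩

/-- The mass of `dμ(t) / t` near `1` is small if there is none on `(0, 1]`. -/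
lemma exists_headMass_le (hμ : ∫⁻ t : Ioi (0 : ℝ), ENNReal.ofReal (1 / (t : ℝ)) ∂μ = 1)
    (h0 : μ {t : Ioi (0 : ℝ) | (t : ℝ) ≤ 1} = 0) {η : ℝ≥0∞} (hη : 0 < η) :
    ∃ τ : ℝ, 1 < τ ∧ headMass μ τ ≤ η := by
  set ν := μ.withDensity fun t : Ioi (0 : ℝ) => ENNReal.ofReal (1 / (t : ℝ)) with hν
  set s : ℕ → Set (Ioi (0 : ℝ)) := fun n => {t | (t : ℝ) < 1 + 1 / ((n : ℝ) + 1)} with hs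
  have hsm : ∀ n, MeasurableSet (s n) := fun n =>
    measurableSet_lt measurable_subtype_coe measurable_const
  have hνs : ∀ n, ν (s n) = headMass μ (1 + 1 / ((n : ℝ) + 1)) := fun n =>
    withDensity_apply _ (hsm n)
  have hanti : Antitone s := fun m n hmn t ht => by
    refine lt_of_lt_of_le (mem_ofPred.1 ht) ?_
    have := Nat.one_div_le_one_div (α := ℝ) hmn
    linarith
  have hfin : ν (s 0) ≠ ∞ := by
    rw [hνs]
    exact ((setLIntegral_le_lintegral _ _).trans_lt (hμ ▸ ENNReal.one_lt_top)).ne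
  have hlim := tendsto_measure_iInter_atTop (fun n => (hsm n).nullMeasurableSet) hanti ⟨0, hfin⟩
  have hzero : ν (⋂ n, s n) = 0 := by
    refine withDensity_absolutelyContinuous _ _ (measure_mono_null (fun t ht => ?_) h0)
    have h1 : ∀ n : ℕ, (t : ℝ) < 1 + 1 / ((n : ℝ) + 1) := fun n => mem_iInter.1 ht n
    have h2 := (tendsto_one_div_add_atTop_nhds_zero_nat (𝕜 := ℝ)).const_add 1
    rw [add_zero] at h2
    exact ge_of_tendsto' h2 fun n => (h1 n).le
  rw [hzero] at hlim
  obtain ⟨n, hn⟩ := (hlim.eventually (gt_mem_nhds hη)).exists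
  refine ⟨1 + 1 / ((n : ℝ) + 1), by have : 0 < 1 / ((n : ℝ) + 1) := by positivity
                                    linarith, ?_⟩
  rw [← hνs]
  exact hn.le

lemma differentiable_hausdorff (hμ : ∫⁻ t : Ioi (0 : ℝ), ENNReal.ofReal (1 / (t : ℝ)) ∂μ = 1)
    (h0 : μ {t : Ioi (0 : ℝ) | (t : ℝ) ≤ 1} = 0) {f : ℂ → ℂ} (hf : Differentiable ℂ f) :
    Differentiable ℂ (hausdorff μ f) := by
  intro z₀
  have hf' : Continuous (deriv f) := (hf.contDiff (n := 1)).continuous_deriv le_rfl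
  obtain ⟨C, hC⟩ := (isCompact_closedBall (0 : ℂ) (‖z₀‖ + 1)).exists_bound_of_continuousOn
    hf'.continuousOn
  have hne : ∀ t : Ioi (0 : ℝ), ((t : ℝ) : ℂ) ≠ 0 := fun t =>
    Complex.ofReal_ne_zero.2 (ne_of_gt t.2)
  have hi : Continuous fun t : Ioi (0 : ℝ) => ((t : ℝ) : ℂ) := by fun_prop
  have hw : Integrable (fun t : Ioi (0 : ℝ) => C * (1 / (t : ℝ))) μ := by
    refine Integrable.const_mul ⟨Measurable.aestronglyMeasurable (by fun_prop), ?_⟩ C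
    refine lt_of_eq_of_lt ?_ ENNReal.one_lt_top
    rw [← hμ]
    refine lintegral_congr fun t => ?_
    have ht : (0 : ℝ) < t := t.2
    rw [← ofReal_norm, Real.norm_of_nonneg (by positivity)]
  have key := hasDerivAt_integral_of_dominated_loc_of_deriv_le (μ := μ)
    (F := fun z t => hausdorffIntegrand f z t)
    (F' := fun z t => deriv f (z / ((t : ℝ) : ℂ)) / ((t : ℝ) : ℂ) / ((t : ℝ) : ℂ))
    (Metric.ball_mem_nhds z₀ one_pos)
    (Eventually.of_forall fun z =>
      (continuous_hausdorffIntegrand hf.continuous z).aestronglyMeasurable)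
    (integrable_hausdorffIntegrand hμ h0 hf.continuous z₀)
    ((((hf'.comp (continuous_const.div hi hne)).div hi hne).div hi hne).aestronglyMeasurable)
    (bound := fun t => C * (1 / (t : ℝ))) ?_ hw ?_
  · exact key.2.differentiableAt
  · filter_upwards [ae_one_lt h0] with t ht z hz
    have ht0 : (0 : ℝ) < t := t.2
    rw [norm_div, norm_div, Complex.norm_real, Real.norm_of_nonneg ht0.le, div_eq_mul_one_div]
    gcongr
    have hzt : ‖z / ((t : ℝ) : ℂ)‖ ≤ ‖z₀‖ + 1 := by
      rw [norm_div, Complex.norm_real, Real.norm_of_nonneg ht0.le]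
      refine (div_le_self (norm_nonneg z) ht.le).trans ?_
      have h1 : ‖z - z₀‖ < 1 := by simpa [dist_eq_norm] using hz
      have h2 := norm_le_norm_add_norm_sub' z z₀
      linarith
    have h3 := hC _ (mem_closedBall_zero_iff.2 hzt)
    exact (div_le_self (norm_nonneg _) ht.le).trans h3
  · filter_upwards with t z _
    have h1 : HasDerivAt (fun z : ℂ => z / ((t : ℝ) : ℂ)) (1 / ((t : ℝ) : ℂ)) z :=
      (hasDerivAt_id z).div_const _
    have h2 := ((hf (z / ((t : ℝ) : ℂ))).hasDerivAt.comp z h1).div_const ((t : ℝ) : ℂ)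
    rw [mul_one_div] at h2
    exact h2

lemma mixedNorm_mono {F G : ℂ → ℝ≥0∞} (h : ∀ z, F z ≤ G z) :
    mixedNorm p q α F ≤ mixedNorm p q α G :=
  radialNorm_mono fun _ hr => circleMean_mono hr fun z _ => h z

lemma fockNorm_hausdorff_le (hμ : ∫⁻ t : Ioi (0 : ℝ), ENNReal.ofReal (1 / (t : ℝ)) ∂μ = 1)
    (h0 : μ {t : Ioi (0 : ℝ) | (t : ℝ) ≤ 1} = 0) (f : ℂ → ℂ) :
    fockNorm p q α (hausdorff μ f) ≤ mixedNorm p q α (radialMax f) := by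
  rw [fockNorm_eq_mixedNorm]
  exact mixedNorm_mono fun z => (enorm_integral_le_lintegral_enorm _).trans
    (lintegral_hausdorffIntegrand_le_radialMax hμ h0 f z)

/-- The quantitative form of compactness: the part of `μ` near `1` contributes little by its small
mass, the rest is controlled by a uniform bound `c` of `f` on a large disc and by the Gaussian decay
outside it. -/
lemma fockNorm_hausdorff_le_of_bound (hp : 0 < p) (hq : 0 < q) (hα : 0 < α)
    (hμ : ∫⁻ t : Ioi (0 : ℝ), ENNReal.ofReal (1 / (t : ℝ)) ∂μ = 1)
    (h0 : μ {t : Ioi (0 : ℝ) | (t : ℝ) ≤ 1} = 0) :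
    ∃ D : ℝ≥0∞, D ≠ ∞ ∧ ∀ τ : ℝ, 1 < τ → ∃ K : ℝ≥0∞, K ≠ ∞ ∧ ∃ b : ℝ, 0 < b ∧
      ∀ f : ℂ → ℂ, Differentiable ℂ f → ∀ R : ℝ, 0 ≤ R → ∀ c : ℝ≥0∞, c ≠ ∞ →
        (∀ z, ‖z‖ ≤ R → ‖f z‖ₑ ≤ c) →
        fockNorm p q α (hausdorff μ f) ≤ D * (headMass μ τ * fockNorm p q α f +
          (c + K * ENNReal.ofReal (Real.exp (-b * R ^ 2)) * fockNorm p q α f)) := by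
  obtain ⟨C, hC, hmax⟩ := mixedNorm_radialMax_le (p := p) (q := q) (α := α) hp hq hα
  obtain ⟨C₁, hC₁, hconst⟩ := radialNorm_const_le (q := q) (α := α) hq hα
  set Qp := quasiConst p with hQp
  set Qq := quasiConst q with hQq
  have hQpt : Qp ≠ ∞ := quasiConst_ne_top p
  have hQqt : Qq ≠ ∞ := quasiConst_ne_top q
  refine ⟨2 * Qp * Qq * (1 + Qp * Qq) * (C + C₁ + 1), ?_, fun τ hτ => ?_⟩
  · finiteness
  have hτ0 : 0 < τ := by linarith
  have hκ : 0 < τ⁻¹ := inv_pos.2 hτ0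
  have hκ1 : τ⁻¹ < 1 := inv_lt_one_of_one_lt₀ hτ
  obtain ⟨K, hK, htail⟩ := radialNorm_dilation_tail (q := q) (α := α) hq hα hκ hκ1
  refine ⟨K * C, ENNReal.mul_ne_top hK hC, α * (1 - τ⁻¹ ^ 2) / 2, ?_, ?_⟩
  · have : τ⁻¹ ^ 2 < 1 := by nlinarith
    have := mul_pos hα (sub_pos.2 this)
    linarith
  intro f hf R hR c hc hfc
  set a := headMass μ τ with ha
  have hat : a ≠ ∞ := ((setLIntegral_le_lintegral _ _).trans_lt (hμ ▸ ENNReal.one_lt_top)).ne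
  set M := radialMax f with hM
  have hMm : Measurable M := measurable_radialMax hf.continuous
  set X : ℂ → ℝ≥0∞ := fun z => if R < ‖z‖ then M ((τ⁻¹ : ℝ) * z) else 0 with hX
  set N := circleMean p M with hN
  set e := ENNReal.ofReal (Real.exp (-(α * (1 - τ⁻¹ ^ 2) / 2) * R ^ 2)) with he
  have hpt : ∀ z, ‖hausdorff μ f z‖ₑ ≤ 2 * max (a * M z) (max c (X z)) := fun z => by
    refine (enorm_integral_le_lintegral_enorm _).trans
      ((lintegral_hausdorffIntegrand_le hμ h0 f z hτ.le).trans ?_)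
    rw [two_mul]
    refine add_le_add (le_max_left _ _) (le_trans ?_ (le_max_right _ _))
    by_cases hz : R < ‖z‖
    · refine le_trans (le_of_eq ?_) (le_max_right _ _)
      simp only [hX, if_pos hz]
      rfl
    · refine le_trans (radialMax_le (R := R) ?_ hfc) (le_max_left _ _)
      rw [norm_mul, Complex.norm_real, Real.norm_of_nonneg hκ.le]
      exact (mul_le_of_le_one_left (norm_nonneg z) hκ1.le).trans (not_lt.1 hz)
  have hXr : ∀ r, 0 ≤ r → circleMean p X r ≤ if R < r then N (τ⁻¹ * r) else 0 := fun r hr => by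
    split_ifs with h
    · refine circleMean_mono_of_sphere (fun u hu => ?_) (by positivity)
      have : ‖(r : ℂ) * u‖ = r := by simp [hu, abs_of_nonneg hr]
      simp only [hX, this, if_pos h]
      rw [Complex.ofReal_mul, mul_assoc]
    · refine (circleMean_mono hr (G := fun _ => 0) fun z hz => ?_).trans
        (circleMean_const_le hp 0 r)
      simp [hX, hz, h]
  have hcirc : ∀ r, 0 ≤ r → circleMean p (fun z => ‖hausdorff μ f z‖ₑ) r ≤
      2 * Qp * max (a * N r) (Qp * max c (if R < r then N (τ⁻¹ * r) else 0)) := fun r hr => by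
    calc _ ≤ circleMean p (fun z => 2 * max (a * M z) (max c (X z))) r :=
          circleMean_mono hr fun z _ => hpt z
      _ = 2 * circleMean p (fun z => max (a * M z) (max c (X z))) r :=
          circleMean_const_mul hp (by simp) _ r
      _ ≤ 2 * (Qp * max (circleMean p (fun z => a * M z) r)
          (circleMean p (fun z => max c (X z)) r)) := by
          gcongr; exact circleMean_max_le hp (hMm.const_mul a) r
      _ ≤ 2 * (Qp * max (a * N r) (Qp * max c (if R < r then N (τ⁻¹ * r) else 0))) := by
          gcongr
          · exact (circleMean_const_mul hp hat M r).le
          · refine (circleMean_max_le hp measurable_const r).trans ?_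
            gcongr
            · exact circleMean_const_le hp c r
            · exact hXr r hr
      _ = _ := by rw [mul_assoc]
  have hNm : MonotoneOn N (Ici 0) := monotoneOn_circleMean_radialMax f
  have hNf : radialNorm q α N ≤ C * fockNorm p q α f := hmax f hf
  set B := fockNorm p q α f with hB
  have hrad : fockNorm p q α (hausdorff μ f) ≤
      2 * Qp * (Qq * max (a * (C * B)) (Qp * (Qq * max (C₁ * c) (K * e * (C * B))))) := by
    rw [fockNorm_eq_mixedNorm]
    refine (radialNorm_mono hcirc).trans ?_
    rw [radialNorm_const_mul hq (by finiteness)]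
    gcongr
    refine (radialNorm_max_le hq fun x hx y hy hxy => mul_le_mul_right (hNm hx hy hxy) a).trans ?_
    gcongr
    · rw [radialNorm_const_mul hq hat]
      gcongr
    · rw [radialNorm_const_mul hq hQpt]
      gcongr
      refine (radialNorm_max_le hq monotoneOn_const).trans ?_
      gcongr
      · exact hconst c hc
      · refine (htail N R hR).trans ?_
        gcongr
  refine hrad.trans ?_
  have hCm : C ≤ C + C₁ + 1 := by rw [add_assoc]; exact le_self_add
  have hC₁m : C₁ ≤ C + C₁ + 1 := le_trans le_add_self le_self_add
  have h1m : 1 ≤ C + C₁ + 1 := le_add_self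
  set L := C + C₁ + 1 with hL
  calc _ ≤ 2 * Qp * (Qq * (a * (C * B) + Qp * (Qq * (C₁ * c + K * e * (C * B))))) := by
        gcongr
        refine (max_le_add_of_nonneg zero_le zero_le).trans ?_
        gcongr
        exact max_le_add_of_nonneg zero_le zero_le
    _ = 2 * Qp * Qq * (C * (a * B) + Qp * Qq * (C₁ * c + 1 * (K * C * e * B))) := by ring
    _ ≤ 2 * Qp * Qq * (L * (a * B) + Qp * Qq * (L * c + L * (K * C * e * B))) := by gcongr
    _ ≤ 2 * Qp * Qq * (L * (a * B) + Qp * Qq * (L * c + L * (K * C * e * B)) +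
        (Qp * Qq * L * (a * B) + L * c + L * (K * C * e * B))) := mul_le_mul_right le_self_add _
    _ = _ := by ring

/-! ### Compactness -/

lemma exists_ofReal_exp_le {b : ℝ} (hb : 0 < b) {η : ℝ≥0∞} (hη : 0 < η) :
    ∃ R : ℝ, 0 ≤ R ∧ ENNReal.ofReal (Real.exp (-b * R ^ 2)) ≤ η := by
  have h1 : Tendsto (fun R : ℝ => -b * R ^ 2) atTop atBot :=
    (tendsto_pow_atTop two_ne_zero).const_mul_atTop_of_neg (neg_lt_zero.2 hb)
  have h2 := ENNReal.tendsto_ofReal (Real.tendsto_exp_atBot.comp h1)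
  rw [ENNReal.ofReal_zero] at h2
  obtain ⟨R, hR0, hR⟩ := ((eventually_ge_atTop 0).and (h2.eventually (gt_mem_nhds hη))).exists
  exact ⟨R, hR0, le_of_lt hR⟩

lemma fockNorm_sub_le {p q : ℝ≥0∞} (hp : 0 < p) (hq : 0 < q) (α : ℝ) {f g : ℂ → ℂ}
    (hf : Continuous f) :
    fockNorm p q α (f - g) ≤
      2 * quasiConst p * quasiConst q * max (fockNorm p q α f) (fockNorm p q α g) := by
  rw [sub_eq_add_neg, ← fockNorm_neg hp hq α g]
  exact fockNorm_add_le hp hq α hf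

lemma mem_fockFilterBasis (p q : ℝ≥0∞) [Fact (0 < p)] [Fact (0 < q)] (α : ℝ)
    (U : Set (MixedFock p q α)) : U ∈ fockFilterBasis p q α ↔
      ∃ ε : ℝ≥0∞, 0 < ε ∧ U = {f : MixedFock p q α | fockNorm p q α f < ε} := Iff.rfl

/-- On bounded sequences converging to zero locally uniformly, the Hausdorff operator converges to
zero in norm. -/
lemma tendsto_fockNorm_hausdorff (hp : 0 < p) (hq : 0 < q) (hα : 0 < α)
    (hμ : ∫⁻ t : Ioi (0 : ℝ), ENNReal.ofReal (1 / (t : ℝ)) ∂μ = 1)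
    (h0 : μ {t : Ioi (0 : ℝ) | (t : ℝ) ≤ 1} = 0) {g : ℕ → ℂ → ℂ} (hg : ∀ n, Differentiable ℂ (g n))
    {B : ℝ≥0∞} (hB : B ≠ ∞) (hgB : ∀ n, fockNorm p q α (g n) ≤ B)
    (hlim : ∀ R ε : ℝ, 0 < ε → ∀ᶠ n in atTop, ∀ z, ‖z‖ ≤ R → ‖g n z‖ ≤ ε) :
    Tendsto (fun n => fockNorm p q α (hausdorff μ (g n))) atTop (𝓝 0) := by
  obtain ⟨D, hD, hmain⟩ := fockNorm_hausdorff_le_of_bound (p := p) (q := q) hp hq hα hμ h0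
  rw [ENNReal.tendsto_nhds_zero]
  intro ε hε
  set δ := ε / (D * 3) with hδ
  have hδ0 : 0 < δ := ENNReal.div_pos hε.ne' (by finiteness)
  obtain ⟨τ, hτ, hhead⟩ := exists_headMass_le hμ h0 (η := δ / B) (ENNReal.div_pos hδ0.ne' hB)
  obtain ⟨K, hK, b, hb, hmain⟩ := hmain τ hτ
  obtain ⟨R, hR, hexp⟩ := exists_ofReal_exp_le hb (η := δ / (K * B))
    (ENNReal.div_pos hδ0.ne' (by finiteness))
  obtain ⟨c, hc0, hcδ⟩ := ENNReal.lt_iff_exists_nnreal_btwn.1 hδ0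
  have hc0' : (0 : ℝ) < c := by exact_mod_cast hc0
  filter_upwards [hlim R c hc0'] with n hn
  have hn' : ∀ z, ‖z‖ ≤ R → ‖g n z‖ₑ ≤ c := fun z hz => by
    rw [← ofReal_norm, ← ENNReal.ofReal_coe_nnreal]
    exact ENNReal.ofReal_le_ofReal (hn z hz)
  calc fockNorm p q α (hausdorff μ (g n))
      ≤ D * (headMass μ τ * fockNorm p q α (g n) +
        (c + K * ENNReal.ofReal (Real.exp (-b * R ^ 2)) * fockNorm p q α (g n))) :=
        hmain (g n) (hg n) R hR c ENNReal.coe_ne_top hn'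
    _ ≤ D * (δ / B * B + (δ + K * (δ / (K * B)) * B)) := by gcongr <;> exact hgB n
    _ ≤ D * (δ + (δ + δ)) := by
        gcongr
        · rw [mul_comm]; exact ENNReal.mul_div_le
        · calc K * (δ / (K * B)) * B = (K * B) * (δ / (K * B)) := by ring
            _ ≤ δ := ENNReal.mul_div_le
    _ = D * 3 * (ε / (D * 3)) := by rw [← hδ]; ring
    _ ≤ ε := ENNReal.mul_div_le

/-- The Hausdorff operator as a linear endomorphism of the mixed norm Fock space, for measures
without mass on `(0, 1]`. -/
def hausdorffLinearMap [hp : Fact (0 < p)] [hq : Fact (0 < q)] (hα : 0 < α)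
    (hμ : ∫⁻ t : Ioi (0 : ℝ), ENNReal.ofReal (1 / (t : ℝ)) ∂μ = 1)
    (h0 : μ {t : Ioi (0 : ℝ) | (t : ℝ) ≤ 1} = 0) : MixedFock p q α →ₗ[ℂ] MixedFock p q α where
  toFun f := ⟨hausdorff μ f, differentiable_hausdorff hμ h0 f.2.1, by
    obtain ⟨C, hC, h⟩ := mixedNorm_radialMax_le (p := p) (q := q) hp.out hq.out hα
    exact ((fockNorm_hausdorff_le hμ h0 f).trans (h f f.2.1)).trans_lt
      (ENNReal.mul_lt_top hC.lt_top f.2.2)⟩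
  map_add' f g := by
    ext z
    have hf := integrable_hausdorffIntegrand hμ h0 f.2.1.continuous z
    have hg := integrable_hausdorffIntegrand hμ h0 g.2.1.continuous z
    refine Eq.trans ?_ (integral_add hf hg)
    refine integral_congr_ae (Eventually.of_forall fun t => ?_)
    simp [hausdorffIntegrand, add_div]
  map_smul' c f := by
    ext z
    refine Eq.trans ?_ (integral_const_mul c _)
    refine integral_congr_ae (Eventually.of_forall fun t => ?_)
    simp [hausdorffIntegrand, mul_div_assoc]

theorem isCompactHausdorff_of_measure_eq_zero [hp : Fact (0 < p)] [hq : Fact (0 < q)] (hα : 0 < α)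
    (hμ : ∫⁻ t : Ioi (0 : ℝ), ENNReal.ofReal (1 / (t : ℝ)) ∂μ = 1)
    (h0 : μ {t : Ioi (0 : ℝ) | (t : ℝ) ≤ 1} = 0) : IsCompactHausdorff p q α μ := by
  set T : MixedFock p q α →ₗ[ℂ] MixedFock p q α := hausdorffLinearMap hα hμ h0 with hT
  refine ⟨T, fun f z => ⟨integrable_hausdorffIntegrand hμ h0 f.2.1.continuous z, rfl⟩,
    T '' {f | fockNorm p q α f ≤ 1}, ?_, ?_⟩
  · refine isCompact_of_exists_subseq (N := fun f : MixedFock p q α => fockNorm p q α f)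
      (mem_fockFilterBasis p q α) fun u hu => ?_
    choose f hf hfu using hu
    have hf1 : ∀ n, fockNorm p q α (f n) ≤ 1 := hf
    have hfd : ∀ n, Differentiable ℂ (f n : ℂ → ℂ) := fun n => (f n).2.1
    obtain ⟨φ, g, hφ, hg, hconv⟩ := exists_subseq_tendsto_of_entire hfd fun R hR => by
      obtain ⟨C, hC, h⟩ := enorm_le_fockNorm (p := p) (q := q) hp.out hq.out hα hR.le
      refine ⟨C.toReal, fun n z hz => ?_⟩
      have h1 : ‖(f n : ℂ → ℂ) z‖ₑ ≤ C :=
        (h (f n) (hfd n) z hz).trans (mul_le_of_le_one_right zero_le (hf1 n))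
      rw [← toReal_enorm]
      exact ENNReal.toReal_mono hC h1
    have hpt : ∀ z, Tendsto (fun n => (f (φ n) : ℂ → ℂ) z) atTop (𝓝 (g z)) := fun z => by
      rw [Metric.tendsto_nhds]
      intro ε hε
      filter_upwards [hconv ‖z‖ (ε / 2) (half_pos hε)] with n hn
      rw [dist_eq_norm]
      exact (hn z le_rfl).trans_lt (half_lt_self hε)
    have hg1 : fockNorm p q α g ≤ 1 := fockNorm_le_of_tendsto hp.out hq.out
      (fun n => (hfd (φ n)).continuous) hpt fun n => hf1 (φ n)
    set G : MixedFock p q α := ⟨g, hg, hg1.trans_lt ENNReal.one_lt_top⟩ with hG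
    refine ⟨T G, ⟨G, hg1, rfl⟩, φ, hφ, ?_⟩
    have heq : ∀ n, ((u (φ n) - T G : MixedFock p q α) : ℂ → ℂ) =
        hausdorff μ ((f (φ n) : ℂ → ℂ) - g) := fun n => by
      rw [← hfu, ← map_sub]
      rfl
    simp_rw [heq]
    refine tendsto_fockNorm_hausdorff hp.out hq.out hα hμ h0 (fun n => (hfd (φ n)).sub hg)
      (B := 2 * quasiConst p * quasiConst q) ?_ (fun n => ?_) hconv
    · have := quasiConst_ne_top p
      have := quasiConst_ne_top q
      finiteness
    · refine (fockNorm_sub_le hp.out hq.out α (hfd _).continuous).trans ?_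
      exact mul_le_of_le_one_right zero_le (max_le (hf1 _) hg1)
  · rw [nhds_zero_eq_comap (mem_fockFilterBasis p q α)]
    refine mem_of_superset (preimage_mem_comap (Iio_mem_nhds one_pos)) fun f hf => ?_
    have hf1 : fockNorm p q α f < 1 := hf
    exact ⟨f, hf1.le, rfl⟩

/-- Monomials belong to all mixed norm Fock spaces: `r ^ n` is dominated by `e^{α r² / 4}`. -/
lemma fockNorm_pow_lt_top (hp : 0 < p) (hq : 0 < q) (hα : 0 < α) (n : ℕ) :
    fockNorm p q α (fun z => z ^ n) < ∞ := by
  set A : ℝ := 1 + (4 / α) ^ n * n.factorial with hA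
  have hA0 : 0 ≤ A := by positivity
  have hbound : ∀ r : ℝ, 0 ≤ r → r ^ n ≤ A * Real.exp (α / 4 * r ^ 2) := fun r hr => by
    have h1 : r ^ n ≤ 1 + (r ^ 2) ^ n := by
      rw [← pow_mul, mul_comm, pow_mul]
      nlinarith [sq_nonneg (r ^ n - 1)]
    have h2 := Real.pow_div_factorial_le_exp (α / 4 * r ^ 2) (by positivity) n
    have h3 : (r ^ 2) ^ n = (4 / α) ^ n * n.factorial * ((α / 4 * r ^ 2) ^ n / n.factorial) := by
      rw [mul_pow (α / 4), div_pow, div_pow]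
      field_simp
    have h4 : 1 ≤ Real.exp (α / 4 * r ^ 2) := Real.one_le_exp (by positivity)
    rw [hA, add_mul, one_mul]
    refine h1.trans (add_le_add h4 ?_)
    rw [h3]
    gcongr
  rw [fockNorm_eq_mixedNorm]
  calc mixedNorm p q α (fun z => ‖z ^ n‖ₑ)
      ≤ radialNorm q α (fun r => ENNReal.ofReal A * ENNReal.ofReal (Real.exp (α / 4 * r ^ 2))) := by
        refine radialNorm_mono fun r hr => ?_
        refine (circleMean_mono hr (G := fun _ => ENNReal.ofReal A *
          ENNReal.ofReal (Real.exp (α / 4 * r ^ 2))) fun z hz => ?_).trans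
            (circleMean_const_le hp _ r)
        rw [← ENNReal.ofReal_mul hA0, ← ofReal_norm, norm_pow, hz]
        exact ENNReal.ofReal_le_ofReal (hbound r hr)
    _ = ENNReal.ofReal A * radialNorm q α fun r => ENNReal.ofReal (Real.exp (α / 4 * r ^ 2)) :=
        radialNorm_const_mul hq ENNReal.ofReal_ne_top _
    _ < ∞ := ENNReal.mul_lt_top ENNReal.ofReal_lt_top (radialNorm_exp_lt_top hq hα)

/-- Monomials are eigenvectors of the Hausdorff operator. -/
lemma hausdorff_const_mul_pow (μ : Measure (Ioi (0 : ℝ))) (c : ℂ) (n : ℕ) (z : ℂ) :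
    hausdorff μ (fun z => c * z ^ n) z = hausdorff μ (fun z => z ^ n) 1 * (c * z ^ n) := by
  rw [hausdorff, hausdorff, ← integral_mul_const]
  refine integral_congr_ae (Eventually.of_forall fun t => ?_)
  simp only [hausdorffIntegrand, div_pow, one_pow]
  ring

/-- The eigenvalues `∫ t^{-n-1} dμ(t)` stay away from zero if `μ` charges `(0, 1]`. -/
lemma lintegral_le_enorm_hausdorff_pow {n : ℕ}
    (hi : Integrable (hausdorffIntegrand (fun z => z ^ n) 1) μ) :
    ∫⁻ t in {t : Ioi (0 : ℝ) | (t : ℝ) ≤ 1}, ENNReal.ofReal (1 / (t : ℝ)) ∂μ ≤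
      ‖hausdorff μ (fun z => z ^ n) 1‖ₑ := by
  have hreal : ∀ t : Ioi (0 : ℝ), hausdorffIntegrand (fun z => z ^ n) 1 t =
      (((1 / (t : ℝ)) ^ n * (1 / (t : ℝ)) : ℝ) : ℂ) := fun t => by
    simp only [hausdorffIntegrand]
    push_cast
    ring
  have hnn : ∀ t : Ioi (0 : ℝ), 0 ≤ (1 / (t : ℝ)) ^ n * (1 / (t : ℝ)) := fun t => by
    have : (0 : ℝ) < t := t.2
    positivity
  have hi' : Integrable (fun t : Ioi (0 : ℝ) => (1 / (t : ℝ)) ^ n * (1 / (t : ℝ))) μ := by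
    refine hi.re.congr (Eventually.of_forall fun t => ?_)
    simp only [hreal t]
    exact Complex.ofReal_re _
  have hs : MeasurableSet {t : Ioi (0 : ℝ) | (t : ℝ) ≤ 1} :=
    measurableSet_le measurable_subtype_coe measurable_const
  rw [hausdorff, integral_congr_ae (Eventually.of_forall hreal), integral_complex_ofReal,
    ← ofReal_norm, Complex.norm_real, Real.norm_of_nonneg (integral_nonneg hnn),
    ofReal_integral_eq_lintegral_ofReal hi' (Eventually.of_forall hnn)]
  refine (setLIntegral_mono' hs fun t ht => ?_).trans (setLIntegral_le_lintegral _ _)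
  have ht0 : (0 : ℝ) < t := t.2
  refine ENNReal.ofReal_le_ofReal (le_mul_of_one_le_left (by positivity) (one_le_pow₀ ?_))
  exact (one_le_div ht0).2 (mem_ofPred.1 ht)

theorem measure_eq_zero_of_isCompactHausdorff [hp : Fact (0 < p)] [hq : Fact (0 < q)] (hα : 0 < α)
    (h : IsCompactHausdorff p q α μ) : μ {t : Ioi (0 : ℝ) | (t : ℝ) ≤ 1} = 0 := by
  obtain ⟨T, hT, K, hK, hKT⟩ := h
  rw [nhds_zero_eq_comap (mem_fockFilterBasis p q α)] at hKT
  obtain ⟨V, hV, hVK⟩ := hKT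
  obtain ⟨ε, hε, hεV⟩ := ENNReal.nhds_zero_basis.mem_iff.1 hV
  obtain ⟨ρ, hρ0, hρε⟩ := ENNReal.lt_iff_exists_nnreal_btwn.1 hε
  -- multiples of the monomials whose norm is `ρ`
  have hpos : ∀ n : ℕ, fockNorm p q α (fun z => z ^ n) ≠ 0 := fun n hn => by
    obtain ⟨C, hC, hev⟩ := enorm_le_fockNorm (p := p) (q := q) hp.out hq.out hα zero_le_one
    have := hev (fun z => z ^ n) (by fun_prop) 1 (by simp)
    simp [hn] at this
  have hfin : ∀ n : ℕ, fockNorm p q α (fun z => z ^ n) ≠ ∞ := fun n =>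
    (fockNorm_pow_lt_top hp.out hq.out hα n).ne
  set c : ℕ → ℝ := fun n => ρ / (fockNorm p q α fun z => z ^ n).toReal with hc
  have hcn : ∀ n, fockNorm p q α ((c n : ℂ) • fun z : ℂ => z ^ n) = ρ := fun n => by
    rw [fockNorm_smul hp.out hq.out, ← ofReal_norm, Complex.norm_real,
      Real.norm_of_nonneg (by positivity), hc, ENNReal.ofReal_div_of_pos
      (ENNReal.toReal_pos (hpos n) (hfin n)), ENNReal.ofReal_toReal (hfin n),
      ENNReal.ofReal_coe_nnreal, ENNReal.div_mul_cancel (hpos n) (hfin n)]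
  set f : ℕ → MixedFock p q α := fun n => ⟨(c n : ℂ) • fun z : ℂ => z ^ n,
    by fun_prop, by rw [hcn]; exact ENNReal.coe_lt_top⟩ with hf
  set l : ℕ → ℂ := fun n => hausdorff μ (fun z => z ^ n) 1 with hl
  have hTf : ∀ n z, (T (f n) : ℂ → ℂ) z = l n * (c n * z ^ n) := fun n z => by
    rw [(hT (f n) z).2]
    exact hausdorff_const_mul_pow μ (c n) n z
  have hTf' : ∀ n, (T (f n) : ℂ → ℂ) = l n • (f n : ℂ → ℂ) := fun n => funext fun z => hTf n z
  have hmem : ∀ n, T (f n) ∈ K := fun n =>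
    hVK (hεV ((hcn n).trans_lt hρε))
  obtain ⟨g, hg⟩ := exists_frequently_lt_of_isCompact (mem_fockFilterBasis p q α) hK hmem
  -- the cluster point vanishes, by comparing values at `z` and `2 z`
  have hg0 : ∀ z, (g : ℂ → ℂ) z = 0 := fun z => by
    obtain ⟨C, hC, hev⟩ := enorm_le_fockNorm (p := p) (q := q) (α := α) hp.out hq.out hα
      (R := 2 * ‖z‖) (by positivity)
    have hfreq : ∀ η : ℝ, 0 < η → ∃ᶠ n in atTop,
        ‖(T (f n) : ℂ → ℂ) z - (g : ℂ → ℂ) z‖ ≤ η ∧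
        ‖(T (f n) : ℂ → ℂ) (2 * z) - (g : ℂ → ℂ) (2 * z)‖ ≤ η := fun η hη => by
      have hη' : 0 < ENNReal.ofReal η / C := ENNReal.div_pos (by simpa using hη) hC
      refine (hg _ hη').mono fun n hn => ?_
      have hw : ∀ w : ℂ, ‖w‖ ≤ 2 * ‖z‖ → ‖(T (f n) : ℂ → ℂ) w - (g : ℂ → ℂ) w‖ ≤ η := by
        intro w hw
        have h1 := hev ((T (f n) - g : MixedFock p q α) : ℂ → ℂ)
          (T (f n) - g : MixedFock p q α).2.1 w hw
        have h2 : ‖((T (f n) - g : MixedFock p q α) : ℂ → ℂ) w‖ₑ ≤ ENNReal.ofReal η :=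
          h1.trans ((mul_le_mul_right hn.le C).trans ENNReal.mul_div_le)
        rw [← ofReal_norm, ENNReal.ofReal_le_ofReal_iff hη.le] at h2
        exact h2
      exact ⟨hw z (by linarith [norm_nonneg z]), hw (2 * z) (by simp)⟩
    rw [← norm_eq_zero]
    refine le_antisymm (le_of_forall_pos_le_add fun η hη => ?_) (norm_nonneg _)
    set W := ‖(g : ℂ → ℂ) (2 * z)‖ + 1 with hW
    have hsmall : ∀ᶠ n : ℕ in atTop, W * (1 / 2 : ℝ) ^ n ≤ η / 2 := by
      have := (tendsto_pow_atTop_nhds_zero_of_lt_one (by norm_num : (0 : ℝ) ≤ 1 / 2)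
        (by norm_num)).const_mul W
      rw [mul_zero] at this
      exact (this.eventually (gt_mem_nhds (half_pos hη))).mono fun n hn => le_of_lt hn
    obtain ⟨n, ⟨h1, h2⟩, h3⟩ := ((hfreq (min (η / 2) 1) (by positivity)).and_eventually
      hsmall).exists
    have h4 : (T (f n) : ℂ → ℂ) z = (T (f n) : ℂ → ℂ) (2 * z) * (1 / 2) ^ n := by
      rw [hTf, hTf, mul_pow, one_div, inv_pow]
      field_simp
    have h5 : ‖(T (f n) : ℂ → ℂ) (2 * z)‖ ≤ W := by
      have := norm_le_norm_add_norm_sub' ((T (f n) : ℂ → ℂ) (2 * z)) ((g : ℂ → ℂ) (2 * z))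
      linarith [min_le_right (η / 2) 1]
    have h6 : ‖(T (f n) : ℂ → ℂ) z‖ ≤ W * (1 / 2) ^ n := by
      rw [h4, norm_mul, norm_pow]
      have : ‖(1 / 2 : ℂ)‖ = 1 / 2 := by norm_num
      rw [this]
      gcongr
    have h7 := norm_le_norm_add_norm_sub ((T (f n) : ℂ → ℂ) z) ((g : ℂ → ℂ) z)
    linarith [min_le_left (η / 2) 1]
  have hgz : (g : ℂ → ℂ) = 0 := funext hg0
  -- so the images of the normalised monomials are frequently small
  set a := ∫⁻ t in {t : Ioi (0 : ℝ) | (t : ℝ) ≤ 1}, ENNReal.ofReal (1 / (t : ℝ)) ∂μ with ha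
  have ha0 : a = 0 := by
    by_contra hne
    have haρ : 0 < a * ρ := pos_iff_ne_zero.2 (mul_ne_zero hne hρ0.ne')
    obtain ⟨n, hn⟩ := (hg _ haρ).exists
    have h1 : ((T (f n) - g : MixedFock p q α) : ℂ → ℂ) = l n • (f n : ℂ → ℂ) := by
      rw [Submodule.coe_sub, hgz, sub_zero, hTf']
    have h2 : fockNorm p q α (l n • (f n : ℂ → ℂ)) = ‖l n‖ₑ * ρ := by
      rw [fockNorm_smul hp.out hq.out, ← hcn n]
    have hint : Integrable (hausdorffIntegrand (fun z => z ^ n) 1) μ := by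
      have hm : (fun z : ℂ => z ^ n) ∈ MixedFock p q α :=
        ⟨by fun_prop, fockNorm_pow_lt_top hp.out hq.out hα n⟩
      exact (hT ⟨_, hm⟩ 1).1
    rw [h1, h2] at hn
    exact hn.not_ge (mul_le_mul_left (lintegral_le_enorm_hausdorff_pow hint) _)
  rw [ha, lintegral_eq_zero_iff measurable_weight] at ha0
  have hs : MeasurableSet {t : Ioi (0 : ℝ) | (t : ℝ) ≤ 1} :=
    measurableSet_le measurable_subtype_coe measurable_const
  refine measure_mono_null (fun t ht => ?_) ((ae_restrict_iff' hs).1 ha0)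
  have ht0 : (0 : ℝ) < t := t.2
  simp only [mem_compl_iff, mem_ofPred_eq, Pi.zero_apply, ENNReal.ofReal_eq_zero, not_forall,
    not_le]
  exact ⟨ht, by positivity⟩

end

theorem theorem6p4 (p q : ℝ≥0∞) [Fact (0 < p)] [Fact (0 < q)] (α : ℝ) (hα : 0 < α)
    (μ : Measure (Ioi (0 : ℝ)))
    (hμ : ∫⁻ t : Ioi (0 : ℝ), ENNReal.ofReal (1 / (t : ℝ)) ∂μ = 1) :
    IsCompactHausdorff p q α μ ↔ μ {t : Ioi (0 : ℝ) | (t : ℝ) ≤ 1} = 0 :=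
  ⟨measure_eq_zero_of_isCompactHausdorff hα, isCompactHausdorff_of_measure_eq_zero hα hμ⟩
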